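/- Let $(\mathcal M,\mathfrak g)$ be a connected, oriented, smooth $2$-dimensional Riemannian manifold of finite area (for instance compact), possibly with Lipschitz boundary: $\mathcal M$ is a subset of a smooth oriented Riemannian surface without boundary and, near each of its points, is in a suitable smooth chart either everything or the closed epigraph of a Lipschitz function. Let $0<\lambda\le 1/2$, let $(\lambda\mathcal M,\mathfrak h)$ be an oriented Riemannian surface of the same kind, and let $\psi:\mathcal M\to\lambda\mathcal M$ be an orientation-preserving diffeomorphism with $\psi^*\mathfrak h=\lambda^2\mathfrak g$. For such surfaces $\mathcal A,\mathcal B$ let $\operatorname{Diff}(\mathcal A,\mathcal B)$ be the set of orientation-preserving smooth diffeomorphisms $\mathcal A\to\mathcal B$ (smooth up to the boundary, with smooth inverse). For $\phi\in\operatorname{Diff}(\mathcal M,\lambda\mathcal M)$ and $p\ge 2$ put $$E_p(\phi)=\frac1{\operatorname{Area}(\mathcal M)}\int_{\mathcal M}\operatorname{dist}^p\bigl(d\phi_x,\operatorname{SO}(T_x\mathcal M,T_{\phi(x)}\lambda\mathcal M)\bigr)\,d\mathrm{Vol}_{\mathfrak g}\in[0,\infty],$$ where $\operatorname{SO}(\cdot,\cdot)$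 is the set of orientation-preserving linear isometries and the distance is the Euclidean (Frobenius) one, and put $F(s)=1-2s$ for $0\le s\le\frac14$, $F(s)=2(\sqrt s-1)^2$ for $s\ge\frac14$. Call $\phi_1,\phi_2\in\operatorname{Diff}(\mathcal A,\mathcal B)$ equivalent if $\phi_1=S\circ\phi_2\circ T$ for some Riemannian isometries $T$ of $\mathcal A$ and $S$ of $\mathcal B$ (which may reverse the orientation). (a) Let $p>2$. Then $$\min_{\phi\in\operatorname{Diff}(\mathcal M,\lambda\mathcal M)}E_p(\phi)=F^{p/2}(\lambda^2)$$ (meaning that the minimum exists and has this value) if and only if there is an area-preserving $\chi\in\operatorname{Diff}(\mathcal M,\mathcal M)$ (that is, $\chi$ has Jacobian $1$) such that the singular values of $d\chi_x$ sum to $1/\lambda$ at every point $x$. In that case $\phi\mapsto\psi^{-1}\circ\phi$ induces a bijection from the set of equivalence classes of minimizers of $E_p$ in $\operatorname{Diff}(\mathcal M,\lambda\mathcal M)$ onto the set of equivalence classes of area-preserving $\chi\in\operatorname{Diff}(\mathcal M,\mathcal M)$ whose singular values sum to $1/\lambda$ at every point. (b) For $p=2$ the same holds with "area-preserving" dropped: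 $\min_{\phi\in\operatorname{Diff}(\mathcal M,\lambda\mathcal M)}E_2(\phi)=F(\lambda^2)$ if and only if there is $\chi\in\operatorname{Diff}(\mathcal M,\mathcal M)$ whose singular values sum to $1/\lambda$ at every point, and in that case $\phi\mapsto\psi^{-1}\circ\phi$ induces a bijection from the equivalence classes of minimizers of $E_2$ in $\operatorname{Diff}(\mathcal M,\lambda\mathcal M)$ onto the equivalence classes of such $\chi$. -/

import Mathlib

open Bundle
open scoped Manifold ContDiff

noncomputable section

namespace SurfaceDistortion

/-! ### Linear algebra: maps between oriented Euclidean planes -/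

section Linear

variable {V W : Type*}
  [NormedAddCommGroup V] [InnerProductSpace ℝ V] [Fact (Module.finrank ℝ V = 2)]
  [NormedAddCommGroup W] [InnerProductSpace ℝ W] [Fact (Module.finrank ℝ W = 2)]

/-- A linear map between oriented planes is orientation preserving if it maps positively oriented
pairs of vectors to positively oriented pairs. -/
def LinOrientationPreserving (oV : Orientation ℝ V (Fin 2)) (oW : Orientation ℝ W (Fin 2))
    (A : V →L[ℝ] W) : Prop :=
  ∀ v w : V, 0 < oV.areaForm v w → 0 < oW.areaForm (A v) (A w)

/-- A linear map between oriented Euclidean planes is area preserving (its Jacobian is `1`) if it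
pulls the oriented area form back to the oriented area form. -/
def LinAreaPreserving (oV : Orientation ℝ V (Fin 2)) (oW : Orientation ℝ W (Fin 2))
    (A : V →L[ℝ] W) : Prop :=
  ∀ v w : V, oW.areaForm (A v) (A w) = oV.areaForm v w

/-- The set `SO(V, W)` of orientation preserving linear isometries. -/
def specialOrthogonal (oV : Orientation ℝ V (Fin 2)) (oW : Orientation ℝ W (Fin 2)) :
    Set (V →L[ℝ] W) :=
  {Q | (∀ v w : V, inner ℝ (Q v) (Q w) = inner ℝ v w) ∧ LinOrientationPreserving oV oW Q}

/-- The Euclidean (Hilbert-Schmidt, Frobenius) norm of a linear map, induced by the inner products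
of its source and its target. -/
def frobeniusNorm [FiniteDimensional ℝ V] (A : V →L[ℝ] W) : ℝ :=
  √(∑ i, ‖A (stdOrthonormalBasis ℝ V i)‖ ^ 2)

/-- The Euclidean distance of a linear map from `SO(V, W)`. -/
def distSO [FiniteDimensional ℝ V] (oV : Orientation ℝ V (Fin 2)) (oW : Orientation ℝ W (Fin 2))
    (A : V →L[ℝ] W) : ℝ :=
  ⨅ Q : specialOrthogonal oV oW, frobeniusNorm (A - (Q : V →L[ℝ] W))

/-- The sum `σ₁(A) + σ₂(A)` of the two singular values of a linear map of Euclidean planes. -/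
def singularValueSum [FiniteDimensional ℝ V] [FiniteDimensional ℝ W] (A : V →L[ℝ] W) : ℝ :=
  (A : V →ₗ[ℝ] W).singularValues 0 + (A : V →ₗ[ℝ] W).singularValues 1

end Linear

/-! ### Riemannian surfaces -/

/-- The Euclidean plane, the model of all surfaces. -/
abbrev Plane : Type := EuclideanSpace ℝ (Fin 2)

section Surface

variable {X : Type*} [TopologicalSpace X] [ChartedSpace Plane X] [IsManifold (𝓡 2) ∞ X]
  [RiemannianBundle (fun x : X ↦ TangentSpace (𝓡 2) x)]

instance (x : X) : Fact (Module.finrank ℝ (TangentSpace (𝓡 2) x) = 2) :=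
  ⟨finrank_euclideanSpace_fin (𝕜 := ℝ) (n := 2)⟩

instance (x : X) : FiniteDimensional ℝ (TangentSpace (𝓡 2) x) :=
  inferInstanceAs (FiniteDimensional ℝ Plane)

/-- The coordinate vector `∂ᵢ` at the point `x`, for the chart around `x₀`
(`0` if `x` is not in the domain of that chart). -/
def coordVec (x₀ : X) (i : Fin 2) (x : X) : TangentSpace (𝓡 2) x :=
  (trivializationAt Plane (TangentSpace (𝓡 2)) x₀).symmL ℝ x (EuclideanSpace.single i (1 : ℝ))

/-- The Gram matrix `gᵢⱼ = ⟪∂ᵢ, ∂ⱼ⟫` of the metric at `x` in the chart around `x₀`. -/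
def gramMatrix (x₀ x : X) : Matrix (Fin 2) (Fin 2) ℝ :=
  Matrix.of fun i j ↦ inner ℝ (coordVec x₀ i x) (coordVec x₀ j x)

/-- The Riemannian area measure of the domain of the chart around `x₀`, which is the measure
`√(det gᵢⱼ) du₁ du₂` in coordinates, extended by zero to the surface. -/
def chartArea [MeasurableSpace X] (x₀ : X) : MeasureTheory.Measure X :=
  MeasureTheory.Measure.map (chartAt Plane x₀).symm
    (((MeasureTheory.volume : MeasureTheory.Measure Plane).restrict
      (chartAt Plane x₀).target).withDensity
        fun u ↦ ENNReal.ofReal √((gramMatrix x₀ ((chartAt Plane x₀).symm u)).det))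

/-- The Riemannian area measure: the least measure that dominates the area measures of the chart
domains. As these agree on overlaps, it is the measure obtained by gluing them. -/
def areaMeasure (X : Type*) [TopologicalSpace X] [ChartedSpace Plane X] [IsManifold (𝓡 2) ∞ X]
    [RiemannianBundle (fun x : X ↦ TangentSpace (𝓡 2) x)] [MeasurableSpace X] :
    MeasureTheory.Measure X :=
  ⨆ x₀ : X, chartArea x₀

/-- An orientation of a surface: an orientation of every tangent plane, depending continuously on
the point (the sign of a coordinate frame `(∂₁, ∂₂)` is locally constant). -/
structure SurfaceOrientation (X : Type*) [TopologicalSpace X] [ChartedSpace Plane X]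
    [IsManifold (𝓡 2) ∞ X] [RiemannianBundle (fun x : X ↦ TangentSpace (𝓡 2) x)] where
  /-- the orientation of the tangent plane at a point -/
  orient (x : X) : Orientation ℝ (TangentSpace (𝓡 2) x) (Fin 2)
  locally_constant (x₀ : X) : ∀ᶠ x in nhds x₀,
    (0 < (orient x).areaForm (coordVec x₀ 0 x) (coordVec x₀ 1 x) ↔
      0 < (orient x₀).areaForm (coordVec x₀ 0 x₀) (coordVec x₀ 1 x₀))

/-- A surface with (possibly empty) Lipschitz boundary is a subset `M` of a surface `X` without
boundary which near each of its points is, in a smooth chart of `X`, either everything or the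
closed epigraph of a Lipschitz function. -/
def HasLipschitzBoundary {X : Type*} [TopologicalSpace X] [ChartedSpace Plane X]
    (M : Set X) : Prop :=
  ∀ x ∈ M, ∃ e ∈ IsManifold.maximalAtlas (𝓡 2) ∞ X, x ∈ e.source ∧
    (e.source ⊆ M ∨
      ∃ (K : NNReal) (f : ℝ → ℝ), LipschitzWith K f ∧
        ∀ y ∈ e.source, y ∈ M ↔ f ((e y : Plane) 0) ≤ (e y : Plane) 1)

end Surface

/-! ### Maps between surfaces -/

section Maps

variable {X : Type*} [TopologicalSpace X] [ChartedSpace Plane X] [IsManifold (𝓡 2) ∞ X]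
  [RiemannianBundle (fun x : X ↦ TangentSpace (𝓡 2) x)] [Nonempty X]
  {Y : Type*} [TopologicalSpace Y] [ChartedSpace Plane Y] [IsManifold (𝓡 2) ∞ Y]
  [RiemannianBundle (fun y : Y ↦ TangentSpace (𝓡 2) y)] [Nonempty Y]
  {M : Set X} {N : Set Y}

/-- A bijection `M ≃ N` as a map of the ambient surfaces. Its values outside `M` are arbitrary;
nothing below depends on them. -/
def ambient (φ : M ≃ N) : X → Y :=
  Function.extend (Subtype.val : M → X) (fun x ↦ (φ x : Y)) (fun _ ↦ Classical.arbitrary Y)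

/-- The differential of `φ : M ≃ N` at a point of `M` (at boundary points: along `M`). -/
def differential (φ : M ≃ N) (x : X) :
    TangentSpace (𝓡 2) x →L[ℝ] TangentSpace (𝓡 2) (ambient φ x) :=
  mfderivWithin (𝓡 2) (𝓡 2) (ambient φ) M x

/-- `φ : M ≃ N` is a smooth diffeomorphism (smooth up to the boundary, like its inverse). -/
def IsSmoothDiffeo (φ : M ≃ N) : Prop :=
  ContMDiffOn (𝓡 2) (𝓡 2) ∞ (ambient φ) M ∧ ContMDiffOn (𝓡 2) (𝓡 2) ∞ (ambient φ.symm) N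

/-- `Diff(M, N)`: the orientation preserving smooth diffeomorphisms. -/
def Diff (oX : SurfaceOrientation X) (oY : SurfaceOrientation Y) (M : Set X) (N : Set Y) :
    Set (M ≃ N) :=
  {φ | IsSmoothDiffeo φ ∧ ∀ x ∈ M,
    LinOrientationPreserving (oX.orient x) (oY.orient (ambient φ x)) (differential φ x)}

/-- `φ^* h = c ^ 2 g`. -/
def ScalesMetric (c : ℝ) (φ : M ≃ N) : Prop :=
  ∀ x ∈ M, ∀ v w : TangentSpace (𝓡 2) x,
    inner ℝ (differential φ x v) (differential φ x w) = c ^ 2 * inner ℝ v w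

/-- Riemannian isometries, orientation preserving or not. -/
def IsRiemannianIsometry (φ : M ≃ N) : Prop :=
  IsSmoothDiffeo φ ∧ ScalesMetric 1 φ

/-- `φ` preserves the oriented area: its Jacobian is everywhere `1`. -/
def IsAreaPreserving (oX : SurfaceOrientation X) (oY : SurfaceOrientation Y) (φ : M ≃ N) : Prop :=
  ∀ x ∈ M, LinAreaPreserving (oX.orient x) (oY.orient (ambient φ x)) (differential φ x)

/-- The singular values of the differential of `φ` add up to the constant `c`. -/
def HasSingularValueSum (c : ℝ) (φ : M ≃ N) : Prop :=
  ∀ x ∈ M, singularValueSum (differential φ x) = c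

/-- The energy `E_p(φ) = ⨍_M dist^p(dφ, SO)`, the mean being taken for the Riemannian area. -/
def energy [MeasurableSpace X] (oX : SurfaceOrientation X) (oY : SurfaceOrientation Y) (p : ℝ)
    (φ : M ≃ N) : ENNReal :=
  MeasureTheory.laverage ((areaMeasure X).restrict M) fun x ↦
    ENNReal.ofReal (distSO (oX.orient x) (oY.orient (ambient φ x)) (differential φ x) ^ p)

/-- `φ₁ = S ∘ φ₂ ∘ T` for isometries `T` of `M` and `S` of `N`. -/
def Equivalent (φ₁ φ₂ : M ≃ N) : Prop :=
  ∃ (T : M ≃ M) (S : N ≃ N), IsRiemannianIsometry T ∧ IsRiemannianIsometry S ∧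
    φ₁ = (T.trans φ₂).trans S

/-- The set of equivalence classes in `Diff(M, N)` of the elements of `A ⊆ Diff(M, N)`. -/
def equivalenceClasses (oX : SurfaceOrientation X) (oY : SurfaceOrientation Y)
    (A : Set (M ≃ N)) : Set (Set (M ≃ N)) :=
  {C | ∃ φ ∈ A, C = {φ' | φ' ∈ Diff oX oY M N ∧ Equivalent φ' φ}}

/-- The diffeomorphisms in `Diff(M, N)` of least `p`-energy. -/
def minimizers [MeasurableSpace X] (oX : SurfaceOrientation X) (oY : SurfaceOrientation Y) (p : ℝ)
    (M : Set X) (N : Set Y) : Set (M ≃ N) :=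
  {φ | φ ∈ Diff oX oY M N ∧ ∀ φ' ∈ Diff oX oY M N, energy oX oY p φ ≤ energy oX oY p φ'}

/-- `min_{φ ∈ Diff(M, N)} E_p(φ) = m`: the minimum exists and is `m`. -/
def MinEnergyEq [MeasurableSpace X] (oX : SurfaceOrientation X) (oY : SurfaceOrientation Y) (p : ℝ)
    (M : Set X) (N : Set Y) (m : ENNReal) : Prop :=
  IsLeast (energy oX oY p '' Diff oX oY M N) m

/-- Self-diffeomorphisms in `Diff(M, M)` whose singular values add up to the constant `c`. -/
def selfMaps (oX : SurfaceOrientation X) (M : Set X) (c : ℝ) : Set (M ≃ M) :=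
  {χ | χ ∈ Diff oX oX M M ∧ HasSingularValueSum c χ}

/-- Area preserving diffeomorphisms in `Diff(M, M)` whose singular values add up to `c`. -/
def areaPreservingSelfMaps (oX : SurfaceOrientation X) (M : Set X) (c : ℝ) : Set (M ≃ M) :=
  {χ | χ ∈ Diff oX oX M M ∧ IsAreaPreserving oX oX χ ∧ HasSingularValueSum c χ}

/-- The map `φ ↦ ψ⁻¹ ∘ φ` from bijections `M → N` to bijections `M → M`. -/
def pullBack (ψ φ : M ≃ N) : M ≃ M := φ.trans ψ.symm

end Maps

/-- The function `F` in the energy bound. -/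
def energyBound (s : ℝ) : ℝ := if s ≤ 1 / 4 then 1 - 2 * s else 2 * (√s - 1) ^ 2

end SurfaceDistortion

end

open SurfaceDistortion

/-! Write `S` for the sum of the singular values of a linear map `A` of oriented planes and `J` for
its oriented Jacobian. If `J > 0`, then `S ^ 2 = ‖A‖ ^ 2 + 2 * J` and the squared distance from the
rotations is `‖A‖ ^ 2 - 2 * S + 2`. Eliminating the Frobenius norm gives `dist² = (S - 1) ^ 2 + 1 -
2 * J` (`distSO_sq_eq`): a square plus a term affine in the Jacobian.

The mean of `J` is the same for all competitors. Indeed `φ = ψ ∘ χ` with `χ = pullBack ψ φ` a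
self-diffeomorphism of `M`, so `J_φ = lam ^ 2 * J_χ`, and the area formula (`areaMeasure_image`,
`lintegral_jacobian_self`) gives `J_χ` mean `1`. Hence the mean of `dist²` is at least `m = 1 - 2 *
lam ^ 2`, which is the value of `F` at `lam ^ 2` because `lam ≤ 1 / 2`; equality means `S = 1`. For
`p > 2` the power `t ↦ t ^ (p / 2)` is bounded below by its tangent line at `m`, and strict
convexity makes equality also force `dist² = m`, that is `J = lam ^ 2`.

The integral only gives equality almost everywhere. All the functions are continuous on `M`, area
charges open sets, and a Lipschitz domain lies in the closure of its interior, so equality holds at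
every point (`laverage_ge_and_eq_iff`, `energy_ge_and_eq_iff`).

Since `ψ` is a homothety, the conditions `S = 1`, `J = lam ^ 2` on `φ` become `S = 1 / lam`, `J = 1`
on `χ`. Conjugation by `ψ` preserves isometries, so the correspondence descends to equivalence
classes (`bijOn_equivalenceClasses`). -/

set_option linter.unusedSectionVars false

noncomputable section

namespace SurfaceDistortion

open MeasureTheory Set Filter Topology

/-! ### Linear maps of Euclidean planes: Jacobian, singular values, distance from the rotations -/

section LinearAlgebra

variable {V W Z : Type*}
  [NormedAddCommGroup V] [InnerProductSpace ℝ V] [Fact (Module.finrank ℝ V = 2)]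
  [NormedAddCommGroup W] [InnerProductSpace ℝ W] [Fact (Module.finrank ℝ W = 2)]
  [NormedAddCommGroup Z] [InnerProductSpace ℝ Z] [Fact (Module.finrank ℝ Z = 2)]
  (oV : Orientation ℝ V (Fin 2)) (oW : Orientation ℝ W (Fin 2)) (oZ : Orientation ℝ Z (Fin 2))

/-- A positively oriented orthonormal frame of an oriented plane. -/
def orientedFrame : OrthonormalBasis (Fin 2) ℝ V :=
  oV.finOrthonormalBasis two_pos Fact.out

lemma areaForm_orientedFrame :
    oV.areaForm (orientedFrame oV 0) (orientedFrame oV 1) = 1 := by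
  have h : ![orientedFrame oV 0, orientedFrame oV 1] = (orientedFrame oV).toBasis := by
    ext i; fin_cases i <;> simp
  rw [Orientation.areaForm_to_volumeForm, oV.volumeForm_robust (orientedFrame oV)
    (oV.finOrthonormalBasis_orientation _ _), h, Module.Basis.det_self]

/-- The oriented Jacobian of a linear map between oriented Euclidean planes. -/
def linJac (A : V →L[ℝ] W) : ℝ :=
  oW.areaForm (A (orientedFrame oV 0)) (A (orientedFrame oV 1))

/-- Alternating forms on a plane are multiples of one another, and the positively oriented
orthonormal frame fixes the factor. -/
lemma areaForm_map_map (A : V →L[ℝ] W) (v w : V) :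
    oW.areaForm (A v) (A w) = linJac oV oW A * oV.areaForm v w := by
  have hs := oW.areaForm_swap (A (orientedFrame oV 1)) (A (orientedFrame oV 0))
  have hs' := oV.areaForm_swap (orientedFrame oV 1) (orientedFrame oV 0)
  have h1 := areaForm_orientedFrame oV
  rw [← (orientedFrame oV).sum_repr v, ← (orientedFrame oV).sum_repr w]
  simp only [Fin.sum_univ_two, map_add, map_smul, LinearMap.add_apply, LinearMap.smul_apply,
    smul_eq_mul, Orientation.areaForm_apply_self, hs, hs', h1, linJac]
  ring

lemma linAreaPreserving_iff (A : V →L[ℝ] W) :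
    LinAreaPreserving oV oW A ↔ linJac oV oW A = 1 := by
  constructor
  · intro h
    have := h (orientedFrame oV 0) (orientedFrame oV 1)
    rwa [areaForm_orientedFrame] at this
  · intro h v w
    rw [areaForm_map_map oV oW, h, one_mul]

lemma linOrientationPreserving_iff (A : V →L[ℝ] W) :
    LinOrientationPreserving oV oW A ↔ 0 < linJac oV oW A := by
  constructor
  · intro h
    exact h (orientedFrame oV 0) (orientedFrame oV 1) (by rw [areaForm_orientedFrame]; norm_num)
  · intro h v w hvw
    rw [areaForm_map_map oV oW]
    positivity

lemma linJac_comp (B : W →L[ℝ] Z) (A : V →L[ℝ] W) :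
    linJac oV oZ (B ∘L A) = linJac oW oZ B * linJac oV oW A := by
  rw [linJac, ContinuousLinearMap.comp_apply, ContinuousLinearMap.comp_apply,
    areaForm_map_map oW oZ]
  rfl

lemma linJac_id : linJac oV oV (ContinuousLinearMap.id ℝ V) = 1 :=
  areaForm_orientedFrame oV

variable {oV} in
lemma gram_det_eq_areaForm_sq (v w : V) :
    ‖v‖ ^ 2 * ‖w‖ ^ 2 - (inner ℝ v w) ^ 2 = oV.areaForm v w ^ 2 := by
  linarith [oV.inner_sq_add_areaForm_sq v w]

/-- Gram determinants see the Jacobian only up to sign, which is why the square appears; this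
version also covers isometries that reverse orientation. -/
lemma linJac_sq_of_scales {A : V →L[ℝ] W} {c : ℝ}
    (h : ∀ v w : V, inner ℝ (A v) (A w) = c ^ 2 * inner ℝ v w) :
    linJac oV oW A ^ 2 = (c ^ 2) ^ 2 := by
  have hn : ∀ v, ‖A v‖ ^ 2 = c ^ 2 * ‖v‖ ^ 2 := fun v ↦ by
    rw [← real_inner_self_eq_norm_sq, h, real_inner_self_eq_norm_sq]
  rw [linJac, ← gram_det_eq_areaForm_sq, hn, hn, h]
  rw [(orientedFrame oV).orthonormal.2 (by decide)]
  simp [OrthonormalBasis.norm_eq_one, sq]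

lemma linJac_of_scales {A : V →L[ℝ] W} {c : ℝ}
    (h : ∀ v w : V, inner ℝ (A v) (A w) = c ^ 2 * inner ℝ v w)
    (ho : LinOrientationPreserving oV oW A) : linJac oV oW A = c ^ 2 := by
  have h0 := (linOrientationPreserving_iff oV oW A).1 ho
  exact (pow_left_inj₀ h0.le (sq_nonneg c) two_ne_zero).1 (linJac_sq_of_scales oV oW h)

section Frobenius

variable [FiniteDimensional ℝ V] [FiniteDimensional ℝ W] [FiniteDimensional ℝ Z]

/-- The trace does not depend on the basis, and it is also the sum of the squared singular values.
-/
lemma sum_norm_sq_eq_trace {ι : Type*} [Fintype ι] (b : OrthonormalBasis ι ℝ V) (A : V →L[ℝ] W) :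
    ∑ i, ‖A (b i)‖ ^ 2 =
      LinearMap.trace ℝ V (LinearMap.adjoint (A : V →ₗ[ℝ] W) ∘ₗ (A : V →ₗ[ℝ] W)) := by
  rw [LinearMap.trace_eq_sum_inner _ b]
  refine Finset.sum_congr rfl fun i _ ↦ ?_
  rw [LinearMap.comp_apply, LinearMap.adjoint_inner_right]
  exact (real_inner_self_eq_norm_sq _).symm

lemma frobeniusNorm_sq_eq_sum {ι : Type*} [Fintype ι] (b : OrthonormalBasis ι ℝ V)
    (A : V →L[ℝ] W) : frobeniusNorm A ^ 2 = ∑ i, ‖A (b i)‖ ^ 2 := by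
  rw [frobeniusNorm, Real.sq_sqrt (by positivity), sum_norm_sq_eq_trace, sum_norm_sq_eq_trace]

/-- The Frobenius norm in terms of an arbitrary frame `v, w`. -/
lemma frobeniusNorm_sq_mul_areaForm_sq (A : V →L[ℝ] W) (v w : V) :
    frobeniusNorm A ^ 2 * oV.areaForm v w ^ 2 =
      ‖A v‖ ^ 2 * ‖w‖ ^ 2 - 2 * inner ℝ (A v) (A w) * inner ℝ v w + ‖A w‖ ^ 2 * ‖v‖ ^ 2 := by
  have hs' := oV.areaForm_swap (orientedFrame oV 1) (orientedFrame oV 0)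
  have h1 := areaForm_orientedFrame oV
  have hb := (orientedFrame oV).orthonormal
  have h00 : inner ℝ (orientedFrame oV 0) (orientedFrame oV 0) = (1 : ℝ) := by
    rw [real_inner_self_eq_norm_sq]; simp
  have h11 : inner ℝ (orientedFrame oV 1) (orientedFrame oV 1) = (1 : ℝ) := by
    rw [real_inner_self_eq_norm_sq]; simp
  have h01 : inner ℝ (orientedFrame oV 0) (orientedFrame oV 1) = (0 : ℝ) := hb.2 (by decide)
  have h10 : inner ℝ (orientedFrame oV 1) (orientedFrame oV 0) = (0 : ℝ) := hb.2 (by decide)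
  have hc := real_inner_comm (A (orientedFrame oV 0)) (A (orientedFrame oV 1))
  rw [frobeniusNorm_sq_eq_sum (orientedFrame oV)]
  rw [← (orientedFrame oV).sum_repr v, ← (orientedFrame oV).sum_repr w]
  simp only [← real_inner_self_eq_norm_sq]
  simp only [Fin.sum_univ_two, map_add, map_smul, LinearMap.add_apply, LinearMap.smul_apply,
    smul_eq_mul, Orientation.areaForm_apply_self, hs', h1, inner_add_left, inner_add_right,
    real_inner_smul_left, real_inner_smul_right, h00, h01, h10, h11, hc]
  ring

lemma frobeniusNorm_sq_comp_of_scales {B : W →L[ℝ] Z} {c : ℝ}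
    (h : ∀ v w : W, inner ℝ (B v) (B w) = c ^ 2 * inner ℝ v w) (A : V →L[ℝ] W) :
    frobeniusNorm (B ∘L A) ^ 2 = c ^ 2 * frobeniusNorm A ^ 2 := by
  rw [frobeniusNorm_sq_eq_sum (stdOrthonormalBasis ℝ V),
    frobeniusNorm_sq_eq_sum (stdOrthonormalBasis ℝ V), Finset.mul_sum]
  refine Finset.sum_congr rfl fun i _ ↦ ?_
  rw [← real_inner_self_eq_norm_sq, ← real_inner_self_eq_norm_sq]
  exact h _ _

lemma singularValueSum_nonneg (A : V →L[ℝ] W) : 0 ≤ singularValueSum A :=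
  add_nonneg (LinearMap.singularValues_nonneg _ _) (LinearMap.singularValues_nonneg _ _)

/-- Both sides square to the Gram determinant of the image of an orthonormal frame. This links the
unsigned Jacobian of the area formula to the oriented one. -/
lemma normDet_eq_abs_linJac (A : V →L[ℝ] W) :
    LinearMap.normDet (A : V →ₗ[ℝ] W) = |linJac oV oW A| := by
  have hgram := LinearMap.normDet_sq_eq_det_gram (A : V →ₗ[ℝ] W) (orientedFrame oV)
  rw [Matrix.det_fin_two] at hgram
  simp only [Matrix.gram_apply, ContinuousLinearMap.coe_coe, real_inner_self_eq_norm_sq] at hgram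
  have hJ : linJac oV oW A ^ 2 = (LinearMap.normDet (A : V →ₗ[ℝ] W)) ^ 2 := by
    rw [linJac, ← gram_det_eq_areaForm_sq]
    rw [real_inner_comm (A (orientedFrame oV 0)) (A (orientedFrame oV 1))] at hgram
    simp only [RCLike.ofReal_real_eq_id, id] at hgram
    rw [hgram]; ring
  rw [← abs_of_nonneg (LinearMap.normDet_nonneg (A : V →ₗ[ℝ] W))]
  exact ((sq_eq_sq_iff_abs_eq_abs _ _).1 hJ).symm

/-- Expand the square: the sum of the squared singular values is the trace of `A* A`, and their
product is the absolute Jacobian. -/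
lemma singularValueSum_sq (A : V →L[ℝ] W) :
    singularValueSum A ^ 2 = frobeniusNorm A ^ 2 + 2 * |linJac oV oW A| := by
  have h2 : Module.finrank ℝ V = 2 := Fact.out
  have htr := (A : V →ₗ[ℝ] W).isSymmetric_adjoint_comp_self.trace_eq_sum_eigenvalues h2
  simp only [Fin.sum_univ_two, ← LinearMap.sq_singularValues_fin] at htr
  have hF : frobeniusNorm A ^ 2 = (A : V →ₗ[ℝ] W).singularValues 0 ^ 2 +
      (A : V →ₗ[ℝ] W).singularValues 1 ^ 2 := by
    rw [frobeniusNorm_sq_eq_sum (stdOrthonormalBasis ℝ V), sum_norm_sq_eq_trace]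
    exact htr
  have hdet := LinearMap.normDet_eq_prod_singularValues (A : V →ₗ[ℝ] W)
  rw [h2, Finset.prod_range_succ, Finset.prod_range_one] at hdet
  rw [← normDet_eq_abs_linJac oV oW, hdet, hF, singularValueSum]
  ring

lemma singularValueSum_comp_of_scales {B : W →L[ℝ] Z} {c : ℝ} (hc : 0 ≤ c)
    (h : ∀ v w : W, inner ℝ (B v) (B w) = c ^ 2 * inner ℝ v w) (A : V →L[ℝ] W) :
    singularValueSum (B ∘L A) = c * singularValueSum A := by
  -- The claim involves no orientation; arbitrary ones are chosen only to apply
  -- `singularValueSum_sq`.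
  let oV : Orientation ℝ V (Fin 2) :=
    ((stdOrthonormalBasis ℝ V).reindex (finCongr Fact.out)).toBasis.orientation
  let oW : Orientation ℝ W (Fin 2) :=
    ((stdOrthonormalBasis ℝ W).reindex (finCongr Fact.out)).toBasis.orientation
  let oZ : Orientation ℝ Z (Fin 2) :=
    ((stdOrthonormalBasis ℝ Z).reindex (finCongr Fact.out)).toBasis.orientation
  have hJ : |linJac oW oZ B| = c ^ 2 := by
    rw [← abs_of_nonneg (sq_nonneg c)]
    exact (sq_eq_sq_iff_abs_eq_abs _ _).1 (linJac_sq_of_scales oW oZ h)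
  refine (pow_left_inj₀ (singularValueSum_nonneg _)
    (mul_nonneg hc (singularValueSum_nonneg _)) two_ne_zero).1 ?_
  rw [mul_pow, singularValueSum_sq oV oZ, singularValueSum_sq oV oW, linJac_comp oV oW oZ,
    frobeniusNorm_sq_comp_of_scales h, abs_mul, hJ]
  ring

/-- There is a rotation taking the unit vector `v` to the unit vector `w`. -/
lemma exists_specialOrthogonal_apply_eq {v : V} {w : W} (hv : ‖v‖ = 1) (hw : ‖w‖ = 1) :
    ∃ Q ∈ specialOrthogonal oV oW, Q v = w ∧
      Q (oV.rightAngleRotation v) = oW.rightAngleRotation w := by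
  let Q : V →L[ℝ] W := (innerSL ℝ v).smulRight w +
    (innerSL ℝ (oV.rightAngleRotation v)).smulRight (oW.rightAngleRotation w)
  have hQ : ∀ x, Q x = (inner ℝ v x : ℝ) • w + (oV.areaForm v x) • oW.rightAngleRotation w := by
    intro x; simp [Q]
  have hin : ∀ x y : V, inner ℝ (Q x) (Q y) = (inner ℝ x y : ℝ) := by
    intro x y
    have := oV.inner_mul_inner_add_areaForm_mul_areaForm v x y
    rw [hv] at this
    rw [hQ, hQ]
    simp only [inner_add_left, inner_add_right, real_inner_smul_left, real_inner_smul_right,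
      Orientation.inner_rightAngleRotation_left, LinearIsometryEquiv.norm_map,
      Orientation.areaForm_apply_self, real_inner_self_eq_norm_sq, hw,
      real_inner_comm (oW.rightAngleRotation w) w]
    linarith
  have h1 : Q v = w := by rw [hQ]; simp [hv]
  have h2 : Q (oV.rightAngleRotation v) = oW.rightAngleRotation w := by
    rw [hQ]; simp [hv]
  refine ⟨Q, ⟨hin, ?_⟩, h1, h2⟩
  rw [linOrientationPreserving_iff]
  have := areaForm_map_map oV oW Q v (oV.rightAngleRotation v)
  rw [h1, h2] at this
  simp [hv, hw] at this
  rw [← this]; norm_num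

lemma frobeniusNorm_sq_eq_of_unit (A : V →L[ℝ] W) {v : V} (hv : ‖v‖ = 1) :
    frobeniusNorm A ^ 2 = ‖A v‖ ^ 2 + ‖A (oV.rightAngleRotation v)‖ ^ 2 := by
  have h := frobeniusNorm_sq_mul_areaForm_sq oV A v (oV.rightAngleRotation v)
  simpa [hv] using h

/-- Expanding the squared norm of the difference of the two sides gives zero, because a rotation has
Jacobian `1`. So a rotation is determined by its value at one unit vector. -/
lemma apply_rightAngleRotation_of_mem_specialOrthogonal {Q : V →L[ℝ] W}
    (hQ : Q ∈ specialOrthogonal oV oW) (v : V) :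
    Q (oV.rightAngleRotation v) = oW.rightAngleRotation (Q v) := by
  have hn : ∀ x, ‖Q x‖ ^ 2 = ‖x‖ ^ 2 := fun x ↦ by
    rw [← real_inner_self_eq_norm_sq, hQ.1, real_inner_self_eq_norm_sq]
  have hJ : linJac oV oW Q = 1 := by
    simpa using linJac_of_scales oV oW (c := 1) (by simpa using hQ.1) hQ.2
  have ha := areaForm_map_map oV oW Q v (oV.rightAngleRotation v)
  rw [hJ, ← Orientation.inner_rightAngleRotation_left,
    Orientation.areaForm_rightAngleRotation_right, real_inner_self_eq_norm_sq] at ha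
  rw [← sub_eq_zero, ← norm_eq_zero, ← sq_eq_zero_iff, norm_sub_sq_real, hn,
    real_inner_comm, ha, LinearIsometryEquiv.norm_map, LinearIsometryEquiv.norm_map, hn]
  ring

/-- Because `Q` commutes with the quarter turns, the whole cross term is an inner product of `Q v`
with a vector independent of `Q`. That vector is twice the value at `v` of the conformal part of
`A`. -/
lemma frobeniusNorm_sub_sq (A : V →L[ℝ] W) {Q : V →L[ℝ] W} {v : V} (hv : ‖v‖ = 1)
    (hQ : Q ∈ specialOrthogonal oV oW) :
    frobeniusNorm (A - Q) ^ 2 = frobeniusNorm A ^ 2 + 2 -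
      2 * inner ℝ (A v - oW.rightAngleRotation (A (oV.rightAngleRotation v))) (Q v) := by
  have hn : ‖Q v‖ ^ 2 = 1 := by
    rw [← real_inner_self_eq_norm_sq, hQ.1, real_inner_self_eq_norm_sq, hv, one_pow]
  rw [frobeniusNorm_sq_eq_of_unit oV _ hv, frobeniusNorm_sq_eq_of_unit oV _ hv,
    sub_apply, sub_apply, norm_sub_sq_real,
    norm_sub_sq_real, apply_rightAngleRotation_of_mem_specialOrthogonal oV oW hQ,
    LinearIsometryEquiv.norm_map, hn, inner_sub_left,
    Orientation.inner_rightAngleRotation_swap]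
  ring

lemma norm_sub_rightAngleRotation_eq {A : V →L[ℝ] W} (hA : 0 ≤ linJac oV oW A) {v : V}
    (hv : ‖v‖ = 1) :
    ‖A v - oW.rightAngleRotation (A (oV.rightAngleRotation v))‖ = singularValueSum A := by
  refine (pow_left_inj₀ (norm_nonneg _) (singularValueSum_nonneg _) two_ne_zero).1 ?_
  have ha := areaForm_map_map oV oW A v (oV.rightAngleRotation v)
  rw [Orientation.areaForm_rightAngleRotation_right, real_inner_self_eq_norm_sq, hv] at ha
  rw [singularValueSum_sq oV oW, abs_of_nonneg hA, frobeniusNorm_sq_eq_of_unit oV _ hv,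
    norm_sub_sq_real, LinearIsometryEquiv.norm_map, Orientation.inner_rightAngleRotation_right, ha]
  ring

lemma distSO_nonneg (A : V →L[ℝ] W) : 0 ≤ distSO oV oW A :=
  Real.iInf_nonneg fun _ ↦ Real.sqrt_nonneg _

/-- By `frobeniusNorm_sub_sq` the task is to maximize a linear function of the unit vector `Q v`.
Cauchy-Schwarz bounds it by `‖u‖`, which is the singular value sum, and the rotation turning `v`
into the direction of `u` attains the bound. -/
lemma distSO_sq {A : V →L[ℝ] W} (hA : 0 < linJac oV oW A) :
    distSO oV oW A ^ 2 = frobeniusNorm A ^ 2 - 2 * singularValueSum A + 2 := by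
  have hv : ‖orientedFrame oV 0‖ = 1 := by simp
  set v := orientedFrame oV 0
  set u := A v - oW.rightAngleRotation (A (oV.rightAngleRotation v)) with hu
  have hS : ‖u‖ = singularValueSum A := norm_sub_rightAngleRotation_eq oV oW hA.le hv
  have hS0 : 0 < ‖u‖ := by
    have := singularValueSum_sq oV oW A
    rw [abs_of_pos hA] at this
    rw [hS]
    refine lt_of_le_of_ne (singularValueSum_nonneg _) fun h ↦ ?_
    rw [← h] at this
    nlinarith [sq_nonneg (frobeniusNorm A)]
  have hw : ‖‖u‖⁻¹ • u‖ = 1 := by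
    rw [norm_smul, norm_inv, norm_norm, inv_mul_cancel₀ hS0.ne']
  obtain ⟨Q₀, hQ₀, hQv, -⟩ := exists_specialOrthogonal_apply_eq oV oW hv hw
  have hval : frobeniusNorm (A - Q₀) ^ 2 = frobeniusNorm A ^ 2 - 2 * singularValueSum A + 2 := by
    rw [frobeniusNorm_sub_sq oV oW A hv hQ₀, hQv, real_inner_smul_right,
      real_inner_self_eq_norm_sq, ← hS]
    field_simp
    ring
  have hmin : distSO oV oW A = frobeniusNorm (A - Q₀) := by
    have : Nonempty (specialOrthogonal oV oW) := ⟨⟨Q₀, hQ₀⟩⟩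
    refine le_antisymm (ciInf_le ⟨0, ?_⟩ (⟨Q₀, hQ₀⟩ : specialOrthogonal oV oW)) (le_ciInf ?_)
    · rintro _ ⟨Q, rfl⟩
      exact Real.sqrt_nonneg _
    · rintro ⟨Q, hQ⟩
      refine (pow_le_pow_iff_left₀ (Real.sqrt_nonneg _) (Real.sqrt_nonneg _) two_ne_zero).1 ?_
      change frobeniusNorm (A - Q₀) ^ 2 ≤ frobeniusNorm (A - Q) ^ 2
      rw [hval, frobeniusNorm_sub_sq oV oW A hv hQ, ← hS]
      have hQn : ‖Q v‖ = 1 := by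
        rw [← sq_eq_sq₀ (norm_nonneg _) zero_le_one, ← real_inner_self_eq_norm_sq, hQ.1,
          real_inner_self_eq_norm_sq, hv]
      have := real_inner_le_norm u (Q v)
      rw [hQn] at this
      linarith
  rw [hmin, hval]

/-- The identity behind the theorem: completing the square isolates the Jacobian, whose integral
does not depend on the map. -/
lemma distSO_sq_eq {A : V →L[ℝ] W} (hA : 0 < linJac oV oW A) :
    distSO oV oW A ^ 2 = (singularValueSum A - 1) ^ 2 + 1 - 2 * linJac oV oW A := by
  have h := singularValueSum_sq oV oW A
  rw [abs_of_pos hA] at h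
  rw [distSO_sq oV oW hA]
  linarith

end Frobenius

end LinearAlgebra

/-! ### Coordinate frames and area densities in charts -/

section ChartArea

variable {X : Type*} [TopologicalSpace X] [ChartedSpace Plane X] [IsManifold (𝓡 2) ∞ X]
  [RiemannianBundle (fun x : X ↦ TangentSpace (𝓡 2) x)]
  {Y : Type*} [TopologicalSpace Y] [ChartedSpace Plane Y] [IsManifold (𝓡 2) ∞ Y]
  [RiemannianBundle (fun y : Y ↦ TangentSpace (𝓡 2) y)]

lemma isManifold_one (X : Type*) [TopologicalSpace X] [ChartedSpace Plane X]
    [IsManifold (𝓡 2) ∞ X] : IsManifold (𝓡 2) 1 X :=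
  IsManifold.of_le (n := ∞) (by exact_mod_cast le_top)

/-- The parametrization of the tangent plane at `x` by the chart around `x₀`. -/
def coordFrame (x₀ x : X) : Plane →L[ℝ] TangentSpace (𝓡 2) x :=
  (trivializationAt Plane (TangentSpace (𝓡 2)) x₀).symmL ℝ x

/-- The coordinates of tangent vectors at `x` in the chart around `x₀`. -/
def coordMap (x₀ x : X) : TangentSpace (𝓡 2) x →L[ℝ] Plane :=
  (trivializationAt Plane (TangentSpace (𝓡 2)) x₀).continuousLinearMapAt ℝ x

lemma coordMap_comp_coordFrame {x₀ x : X} (hx : x ∈ (chartAt Plane x₀).source) :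
    coordMap x₀ x ∘L coordFrame x₀ x = ContinuousLinearMap.id ℝ Plane := by
  ext1 v
  exact (trivializationAt Plane (TangentSpace (𝓡 2)) x₀).continuousLinearMapAt_symmL hx v

lemma coordFrame_comp_coordMap {x₀ x : X} (hx : x ∈ (chartAt Plane x₀).source) :
    coordFrame x₀ x ∘L coordMap x₀ x = ContinuousLinearMap.id ℝ (TangentSpace (𝓡 2) x) := by
  ext1 v
  exact (trivializationAt Plane (TangentSpace (𝓡 2)) x₀).symmL_continuousLinearMapAt hx v

/-- The Jacobian of a linear map of Euclidean planes, without sign. -/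
abbrev absJac {V W : Type*} [NormedAddCommGroup V] [InnerProductSpace ℝ V] [FiniteDimensional ℝ V]
    [NormedAddCommGroup W] [InnerProductSpace ℝ W] (A : V →L[ℝ] W) : ℝ :=
  LinearMap.normDet (A : V →ₗ[ℝ] W)

lemma sqrt_det_gramMatrix (x₀ x : X) :
    √((gramMatrix x₀ x).det) = absJac (coordFrame x₀ x) := by
  have h := LinearMap.normDet_sq_eq_det_gram (coordFrame x₀ x : Plane →ₗ[ℝ] TangentSpace (𝓡 2) x)
    (EuclideanSpace.basisFun (Fin 2) ℝ)
  rw [absJac, ← Real.sqrt_sq (LinearMap.normDet_nonneg _)]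
  congr 1
  refine Eq.trans ?_ h.symm
  congr 1
  ext i j
  simp only [gramMatrix, Matrix.of_apply, Matrix.gram_apply, EuclideanSpace.basisFun_apply]
  rfl

lemma absJac_coordFrame_pos {x₀ x : X} (hx : x ∈ (chartAt Plane x₀).source) :
    0 < absJac (coordFrame x₀ x) := by
  refine lt_of_le_of_ne (LinearMap.normDet_nonneg _) (Ne.symm fun h ↦ ?_)
  rw [LinearMap.normDet_eq_zero_iff_ker_ne_bot] at h
  apply h
  rw [LinearMap.ker_eq_bot]
  have hl : Function.LeftInverse (coordMap x₀ x) (coordFrame x₀ x) := fun v ↦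
    DFunLike.congr_fun (coordMap_comp_coordFrame hx) v
  exact hl.injective

/-- The differential of a map in the charts around `x₀` and `y₀`. -/
lemma hasFDerivWithinAt_chart {f : X → Y} {s : Set X} {x₀ : X} {u : Plane} {y₀ : Y}
    {f' : TangentSpace (𝓡 2) ((chartAt Plane x₀).symm u) →L[ℝ]
      TangentSpace (𝓡 2) (f ((chartAt Plane x₀).symm u))}
    (hf : HasMFDerivWithinAt (𝓡 2) (𝓡 2) f s ((chartAt Plane x₀).symm u) f')
    (hs : s ⊆ (chartAt Plane x₀).source) (hu : u ∈ (chartAt Plane x₀).target)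
    (hy : f ((chartAt Plane x₀).symm u) ∈ (chartAt Plane y₀).source) :
    HasFDerivWithinAt (chartAt Plane y₀ ∘ f ∘ (chartAt Plane x₀).symm)
      (coordMap y₀ (f ((chartAt Plane x₀).symm u)) ∘L f' ∘L
        coordFrame x₀ ((chartAt Plane x₀).symm u))
      (chartAt Plane x₀ '' s) u := by
  have := isManifold_one X
  have := isManifold_one Y
  have h1 : HasMFDerivAt (𝓡 2) 𝓘(ℝ, Plane) (extChartAt (𝓡 2) y₀)
      (f ((chartAt Plane x₀).symm u)) (coordMap y₀ (f ((chartAt Plane x₀).symm u))) := by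
    have h := (mdifferentiableAt_extChartAt (I := 𝓡 2) hy).hasMFDerivAt
    rwa [← TangentBundle.continuousLinearMapAt_trivializationAt hy] at h
  have hx := (chartAt Plane x₀).map_target hu
  have h2 : HasMFDerivWithinAt 𝓘(ℝ, Plane) (𝓡 2) (extChartAt (𝓡 2) x₀).symm
      (range (𝓡 2)) u (coordFrame x₀ ((chartAt Plane x₀).symm u)) := by
    have h := (mdifferentiableWithinAt_extChartAt_symm (I := 𝓡 2) (x := x₀)
      (z := u) (by simpa using hu)).hasMFDerivWithinAt
    have h' := TangentBundle.symmL_trivializationAt (I := 𝓡 2) hx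
    have hu' : extChartAt (𝓡 2) x₀ ((chartAt Plane x₀).symm u) = u := by
      simp [hu]
    rw [hu'] at h'
    rw [← h'] at h
    exact h
  have h3 : HasMFDerivWithinAt 𝓘(ℝ, Plane) (𝓡 2) (chartAt Plane x₀).symm
      (chartAt Plane x₀ '' s) u (coordFrame x₀ ((chartAt Plane x₀).symm u)) :=
    h2.mono (by simp)
  have hsub : chartAt Plane x₀ '' s ⊆ (chartAt Plane x₀).symm ⁻¹' s := by
    rintro _ ⟨x, hx, rfl⟩
    rwa [mem_preimage, (chartAt Plane x₀).left_inv (hs hx)]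
  exact (h1.comp_hasMFDerivWithinAt u (hf.comp u h3 hsub)).hasFDerivWithinAt

/-- Multiplicativity of Jacobians, applied to the two ways around the square formed by `A` and its
coordinate expression. It is the compatibility of the densities needed in the change of variables.
-/
lemma absJac_coordFrame_comp {x₀ x : X} {y₀ y : Y}
    (A : TangentSpace (𝓡 2) x →L[ℝ] TangentSpace (𝓡 2) y) (hy : y ∈ (chartAt Plane y₀).source) :
    |(coordMap y₀ y ∘L A ∘L coordFrame x₀ x).det| * absJac (coordFrame y₀ y) =
      absJac A * absJac (coordFrame x₀ x) := by
  have h2 : Module.finrank ℝ Plane = 2 := finrank_euclideanSpace_fin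
  have h2x : Module.finrank ℝ (TangentSpace (𝓡 2) x) = 2 := Fact.out
  have h2y : Module.finrank ℝ (TangentSpace (𝓡 2) y) = 2 := Fact.out
  have key : coordFrame y₀ y ∘L (coordMap y₀ y ∘L A ∘L coordFrame x₀ x) = A ∘L coordFrame x₀ x := by
    rw [← ContinuousLinearMap.comp_assoc, coordFrame_comp_coordMap hy]
    rfl
  have hA := LinearMap.normDet_comp_of_finrank_eq
    (coordFrame x₀ x : Plane →ₗ[ℝ] TangentSpace (𝓡 2) x) (A : _ →ₗ[ℝ] TangentSpace (𝓡 2) y)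
    (h2.trans h2x.symm)
  have hD := LinearMap.normDet_comp_of_finrank_eq
    ((coordMap y₀ y ∘L A ∘L coordFrame x₀ x : Plane →L[ℝ] Plane) : Plane →ₗ[ℝ] Plane)
    (coordFrame y₀ y : Plane →ₗ[ℝ] TangentSpace (𝓡 2) y) rfl
  rw [LinearMap.normDet_eq_abs_det] at hD
  rw [mul_comm]
  refine (hD.symm.trans ?_).trans hA
  exact congrArg (fun B : Plane →L[ℝ] TangentSpace (𝓡 2) y ↦ absJac B) key

section Continuity

variable [IsContMDiffRiemannianBundle (𝓡 2) ∞ Plane (fun x : X ↦ TangentSpace (𝓡 2) x)]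

lemma continuousOn_coordVec (x₀ : X) (i : Fin 2) :
    ContinuousOn (fun x ↦ (⟨x, coordVec x₀ i x⟩ : TangentBundle (𝓡 2) X))
      (chartAt Plane x₀).source := by
  have := isManifold_one X
  have h := (trivializationAt Plane (TangentSpace (𝓡 2)) x₀).continuousOn_symm
  have h' : ContinuousOn (fun x : X ↦ (x, (EuclideanSpace.single i (1 : ℝ) : Plane)))
    (chartAt Plane x₀).source := by fun_prop
  refine (h.comp h' fun x hx ↦ ⟨hx, mem_univ _⟩).congr fun x hx ↦ ?_
  simp only [Function.comp, coordVec]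
  congr 1
  exact Trivialization.symmL_apply _ hx _

lemma isContinuousRiemannianBundle (X : Type*) [TopologicalSpace X] [ChartedSpace Plane X]
    [IsManifold (𝓡 2) ∞ X] [RiemannianBundle (fun x : X ↦ TangentSpace (𝓡 2) x)]
    [IsContMDiffRiemannianBundle (𝓡 2) ∞ Plane (fun x : X ↦ TangentSpace (𝓡 2) x)] :
    IsContinuousRiemannianBundle Plane (fun x : X ↦ TangentSpace (𝓡 2) x) := by
  obtain ⟨g, hg, h⟩ := IsContMDiffRiemannianBundle.exists_contMDiff (IB := 𝓡 2) (n := ∞)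
    (F := Plane) (E := fun x : X ↦ TangentSpace (𝓡 2) x)
  exact ⟨g, hg.continuous, h⟩

lemma continuousOn_inner_coordVec (x₀ : X) (i j : Fin 2) :
    ContinuousOn (fun x ↦ (inner ℝ (coordVec x₀ i x) (coordVec x₀ j x) : ℝ))
      (chartAt Plane x₀).source := by
  have := isManifold_one X
  have := isContinuousRiemannianBundle X
  exact (continuousOn_coordVec x₀ i).inner_bundle (continuousOn_coordVec x₀ j)

lemma continuousOn_absJac_coordFrame (x₀ : X) :
    ContinuousOn (fun x ↦ absJac (coordFrame x₀ x)) (chartAt Plane x₀).source := by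
  have h : ContinuousOn (fun x ↦ √((gramMatrix x₀ x).det)) (chartAt Plane x₀).source := by
    refine ContinuousOn.sqrt ?_
    simp only [Matrix.det_fin_two, gramMatrix, Matrix.of_apply]
    exact ((continuousOn_inner_coordVec x₀ 0 0).mul (continuousOn_inner_coordVec x₀ 1 1)).sub
      ((continuousOn_inner_coordVec x₀ 0 1).mul (continuousOn_inner_coordVec x₀ 1 0))
  exact h.congr fun x _ ↦ (sqrt_det_gramMatrix x₀ x).symm

end Continuity

end ChartArea

/-! ### The Riemannian area measure and the area formula -/

section AreaMeasure

variable {X : Type*} [TopologicalSpace X] [ChartedSpace Plane X] [IsManifold (𝓡 2) ∞ X]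
  [RiemannianBundle (fun x : X ↦ TangentSpace (𝓡 2) x)]
  [IsContMDiffRiemannianBundle (𝓡 2) ∞ Plane (fun x : X ↦ TangentSpace (𝓡 2) x)]
  [MeasurableSpace X] [BorelSpace X]
  {Y : Type*} [TopologicalSpace Y] [ChartedSpace Plane Y] [IsManifold (𝓡 2) ∞ Y]
  [RiemannianBundle (fun y : Y ↦ TangentSpace (𝓡 2) y)]
  [IsContMDiffRiemannianBundle (𝓡 2) ∞ Plane (fun y : Y ↦ TangentSpace (𝓡 2) y)]
  [MeasurableSpace Y] [BorelSpace Y]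

lemma _root_.ContinuousOn.measurableSet_inter_preimage {α β : Type*} [TopologicalSpace α]
    [MeasurableSpace α] [OpensMeasurableSpace α] [TopologicalSpace β] [MeasurableSpace β]
    [BorelSpace β] {f : α → β} {s : Set α} {t : Set β} (hf : ContinuousOn f s)
    (hs : MeasurableSet s) (ht : MeasurableSet t) : MeasurableSet (s ∩ f ⁻¹' t) := by
  have h := hs.subtype_image (hf.domRestrict.measurable ht)
  convert h using 1
  ext x
  simp [Set.domRestrict, and_comm]

omit [IsContMDiffRiemannianBundle (𝓡 2) ∞ Plane (fun x : X ↦ TangentSpace (𝓡 2) x)]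
  [RiemannianBundle (fun x : X ↦ TangentSpace (𝓡 2) x)] [IsManifold (𝓡 2) ∞ X] in
lemma measurableSet_chart_image {x₀ : X} {s : Set X} (hs : MeasurableSet s)
    (hs' : s ⊆ (chartAt Plane x₀).source) : MeasurableSet (chartAt Plane x₀ '' s) := by
  rw [(chartAt Plane x₀).image_eq_target_inter_inv_preimage hs']
  exact (chartAt Plane x₀).continuousOn_symm.measurableSet_inter_preimage
    (chartAt Plane x₀).open_target.measurableSet hs

lemma aemeasurable_chart_symm (x₀ : X) :
    AEMeasurable (chartAt Plane x₀).symm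
      (((volume : Measure Plane).restrict (chartAt Plane x₀).target).withDensity
        fun u ↦ ENNReal.ofReal √((gramMatrix x₀ ((chartAt Plane x₀).symm u)).det)) :=
  ((chartAt Plane x₀).continuousOn_symm.aemeasurable
    (chartAt Plane x₀).open_target.measurableSet).mono_ac (withDensity_absolutelyContinuous _ _)

lemma continuousOn_absJac_coordFrame_symm (x₀ : X) :
    ContinuousOn (fun u ↦ absJac (coordFrame x₀ ((chartAt Plane x₀).symm u)))
      (chartAt Plane x₀).target :=
  (continuousOn_absJac_coordFrame x₀).comp (chartAt Plane x₀).continuousOn_symm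
    (chartAt Plane x₀).symm.mapsTo

lemma lintegral_chartArea (x₀ : X) {g : X → ENNReal} (hg : AEMeasurable g (chartArea x₀)) :
    ∫⁻ x, g x ∂(chartArea x₀) = ∫⁻ u in (chartAt Plane x₀).target,
      ENNReal.ofReal (absJac (coordFrame x₀ ((chartAt Plane x₀).symm u))) *
        g ((chartAt Plane x₀).symm u) := by
  have hm := aemeasurable_chart_symm x₀
  unfold chartArea at hg ⊢
  simp only [sqrt_det_gramMatrix] at hg hm ⊢
  rw [lintegral_map' hg hm]
  have hd : AEMeasurable (fun u ↦ ENNReal.ofReal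
      (absJac (coordFrame x₀ ((chartAt Plane x₀).symm u))))
      ((volume : Measure Plane).restrict (chartAt Plane x₀).target) :=
    ((continuousOn_absJac_coordFrame_symm x₀).aemeasurable
      (chartAt Plane x₀).open_target.measurableSet).ennreal_ofReal
  exact lintegral_withDensity_eq_lintegral_mul₀' hd (hg.comp_aemeasurable hm)

lemma setLIntegral_chartArea {x₀ : X} {s : Set X} (hs : MeasurableSet s)
    (hs' : s ⊆ (chartAt Plane x₀).source) {g : X → ENNReal}
    (hg : AEMeasurable g ((chartArea x₀).restrict s)) :
    ∫⁻ x in s, g x ∂(chartArea x₀) = ∫⁻ u in chartAt Plane x₀ '' s,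
      ENNReal.ofReal (absJac (coordFrame x₀ ((chartAt Plane x₀).symm u))) *
        g ((chartAt Plane x₀).symm u) := by
  have himg := measurableSet_chart_image hs hs'
  have hsub : chartAt Plane x₀ '' s ⊆ (chartAt Plane x₀).target := by
    rintro _ ⟨x, hx, rfl⟩
    exact (chartAt Plane x₀).map_source (hs' hx)
  rw [← lintegral_indicator hs, lintegral_chartArea x₀ ((aemeasurable_indicator_iff hs).2 hg)]
  rw [← Measure.restrict_restrict_of_subset hsub, ← lintegral_indicator himg]
  refine setLIntegral_congr_fun (chartAt Plane x₀).open_target.measurableSet fun u hu ↦ ?_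
  by_cases h : (chartAt Plane x₀).symm u ∈ s
  · have hu' : u ∈ chartAt Plane x₀ '' s := ⟨_, h, (chartAt Plane x₀).right_inv hu⟩
    simp only [indicator_of_mem h, indicator_of_mem hu']
  · have hu' : u ∉ chartAt Plane x₀ '' s := by
      rintro ⟨x, hx, rfl⟩
      rw [(chartAt Plane x₀).left_inv (hs' hx)] at h
      exact h hx
    simp only [indicator_of_notMem h, indicator_of_notMem hu', mul_zero]

lemma chartArea_apply {x₀ : X} {s : Set X} (hs : MeasurableSet s)
    (hs' : s ⊆ (chartAt Plane x₀).source) :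
    chartArea x₀ s = ∫⁻ u in chartAt Plane x₀ '' s,
      ENNReal.ofReal (absJac (coordFrame x₀ ((chartAt Plane x₀).symm u))) := by
  simpa using setLIntegral_chartArea hs hs' (g := fun _ ↦ 1) aemeasurable_const

lemma chartArea_compl_source (x₀ : X) : chartArea x₀ (chartAt Plane x₀).sourceᶜ = 0 := by
  have hm : MeasurableSet (chartAt Plane x₀).sourceᶜ :=
    (chartAt Plane x₀).open_source.measurableSet.compl
  rw [← lintegral_indicator_one hm]
  refine (lintegral_chartArea x₀ (aemeasurable_one.indicator hm)).trans ?_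
  rw [setLIntegral_congr_fun (g := fun _ ↦ 0) (chartAt Plane x₀).open_target.measurableSet]
  · simp
  · intro u hu
    have : (chartAt Plane x₀).symm u ∉ (chartAt Plane x₀).sourceᶜ :=
      not_not.2 ((chartAt Plane x₀).map_target hu)
    simp only [indicator_of_notMem this, mul_zero]

/-- Change of variables between two chart domains. -/
theorem chartArea_image {f : X → Y}
    {f' : ∀ x, TangentSpace (𝓡 2) x →L[ℝ] TangentSpace (𝓡 2) (f x)} {s : Set X} {x₀ : X} {y₀ : Y}
    (hs : MeasurableSet s) (hs' : s ⊆ (chartAt Plane x₀).source)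
    (hfs : MapsTo f s (chartAt Plane y₀).source) (hinj : InjOn f s)
    (hf : ∀ x ∈ s, HasMFDerivWithinAt (𝓡 2) (𝓡 2) f s x (f' x))
    (hg : AEMeasurable (fun x ↦ ENNReal.ofReal (absJac (f' x))) ((chartArea x₀).restrict s)) :
    MeasurableSet (f '' s) ∧
      chartArea y₀ (f '' s) = ∫⁻ x in s, ENNReal.ofReal (absJac (f' x)) ∂(chartArea x₀) := by
  set F := chartAt Plane y₀ ∘ f ∘ (chartAt Plane x₀).symm with hF
  set F' : Plane → Plane →L[ℝ] Plane := fun u ↦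
    coordMap y₀ (f ((chartAt Plane x₀).symm u)) ∘L f' ((chartAt Plane x₀).symm u) ∘L
        coordFrame x₀ ((chartAt Plane x₀).symm u) with hF'
  have himg := measurableSet_chart_image hs hs'
  have hsymm : ∀ u ∈ chartAt Plane x₀ '' s, (chartAt Plane x₀).symm u ∈ s ∧
      u ∈ (chartAt Plane x₀).target := by
    rintro _ ⟨x, hx, rfl⟩
    rw [(chartAt Plane x₀).left_inv (hs' hx)]
    exact ⟨hx, (chartAt Plane x₀).map_source (hs' hx)⟩
  have hder : ∀ u ∈ chartAt Plane x₀ '' s,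
      HasFDerivWithinAt F (F' u) (chartAt Plane x₀ '' s) u := fun u hu ↦
    hasFDerivWithinAt_chart (hf _ (hsymm u hu).1) hs' (hsymm u hu).2 (hfs (hsymm u hu).1)
  have hFinj : InjOn F (chartAt Plane x₀ '' s) := by
    intro u hu v hv huv
    have h1 := (chartAt Plane y₀).injOn (hfs (hsymm u hu).1) (hfs (hsymm v hv).1) huv
    exact (chartAt Plane x₀).symm.injOn (hsymm u hu).2 (hsymm v hv).2
      (hinj (hsymm u hu).1 (hsymm v hv).1 h1)
  have hFimg : F '' (chartAt Plane x₀ '' s) = chartAt Plane y₀ '' (f '' s) := by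
    rw [image_image, image_image]
    refine image_congr fun x hx ↦ ?_
    simp only [hF, Function.comp, (chartAt Plane x₀).left_inv (hs' hx)]
  have hFm : MeasurableSet (chartAt Plane y₀ '' (f '' s)) := by
    rw [← hFimg]
    exact measurable_image_of_fderivWithin himg hder hFinj
  have hfsub : f '' s ⊆ (chartAt Plane y₀).source := image_subset_iff.2 hfs
  have hfm : MeasurableSet (f '' s) := by
    have h := (chartAt Plane y₀).continuousOn.measurableSet_inter_preimage
      (chartAt Plane y₀).open_source.measurableSet hFm
    convert h using 1
    ext y
    constructor
    · exact fun hy ↦ ⟨hfsub hy, mem_image_of_mem _ hy⟩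
    · rintro ⟨hy, z, hz, hzy⟩
      rwa [← (chartAt Plane y₀).injOn (hfsub hz) hy hzy]
  refine ⟨hfm, ?_⟩
  rw [chartArea_apply hfm hfsub, ← hFimg,
    lintegral_image_eq_lintegral_abs_det_fderiv_mul volume himg hder hFinj,
    setLIntegral_chartArea hs hs' hg]
  refine setLIntegral_congr_fun himg fun u hu ↦ ?_
  have hy := hfs (hsymm u hu).1
  have hleft : (chartAt Plane y₀).symm (F u) = f ((chartAt Plane x₀).symm u) :=
    (chartAt Plane y₀).left_inv hy
  change _ * ENNReal.ofReal (absJac (coordFrame y₀ ((chartAt Plane y₀).symm (F u)))) = _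
  rw [hleft, ← ENNReal.ofReal_mul (abs_nonneg _), ← ENNReal.ofReal_mul (LinearMap.normDet_nonneg _)]
  congr 1
  exact (absJac_coordFrame_comp (f' ((chartAt Plane x₀).symm u)) hy).trans (mul_comm _ _)

/-- Change of variables for the identity map, read in two different charts. -/
lemma chartArea_eq_of_subset {x₀ x₁ : X} {s : Set X} (hs : MeasurableSet s)
    (h₀ : s ⊆ (chartAt Plane x₀).source) (h₁ : s ⊆ (chartAt Plane x₁).source) :
    chartArea x₁ s = chartArea x₀ s := by
  have hid : ∀ x : X, absJac (ContinuousLinearMap.id ℝ (TangentSpace (𝓡 2) x)) = 1 := fun x ↦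
    LinearMap.normDet_id
  have h := (chartArea_image (f := id) (f' := fun x ↦ ContinuousLinearMap.id ℝ _) (x₀ := x₀)
    (y₀ := x₁) hs h₀ h₁ (injOn_id s)
    (fun x _ ↦ hasMFDerivWithinAt_id s x) (by
      simp only [hid]
      exact aemeasurable_const)).2
  simp only [hid, id] at h
  simpa using h

section Gluing

variable [SecondCountableTopology X] [Nonempty X] [SecondCountableTopology Y] [Nonempty Y]

lemma exists_chart_partition (X : Type*) [TopologicalSpace X] [ChartedSpace Plane X]
    [SecondCountableTopology X] [Nonempty X] [MeasurableSpace X] [BorelSpace X] :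
    ∃ (c : ℕ → X) (D : ℕ → Set X), (∀ n, MeasurableSet (D n)) ∧
      (∀ n, D n ⊆ (chartAt Plane (c n)).source) ∧ Pairwise (Function.onFun Disjoint D) ∧
      ⋃ n, D n = univ := by
  obtain ⟨t, ht, htU⟩ := TopologicalSpace.countable_cover_nhds
    (fun x : X ↦ (chartAt Plane x).open_source.mem_nhds (mem_chart_source Plane x))
  have hne : t.Nonempty := by
    by_contra h
    rw [not_nonempty_iff_eq_empty] at h
    simp [h] at htU
    exact (univ_nonempty (α := X)).ne_empty htU.symm
  obtain ⟨c, rfl⟩ := ht.exists_eq_range hne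
  refine ⟨c, disjointed fun n ↦ (chartAt Plane (c n)).source, ?_, disjointed_subset _,
    disjoint_disjointed _, ?_⟩
  · exact fun n ↦ MeasurableSet.disjointed
      (fun n ↦ (chartAt Plane (c n)).open_source.measurableSet) n
  · rw [iUnion_disjointed]
    simpa using htU

/-- A supremum of measures is not computed setwise, so a candidate `ν` is glued from a countable
disjoint partition subordinate to charts. It agrees with each chart measure on that chart's domain
and hence dominates them all, which squeezes the supremum. -/
lemma areaMeasure_apply {x₀ : X} {s : Set X} (hs : MeasurableSet s)
    (hs' : s ⊆ (chartAt Plane x₀).source) : areaMeasure X s = chartArea x₀ s := by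
  obtain ⟨c, D, hDm, hDs, hDd, hDU⟩ := exists_chart_partition X
  set ν : Measure X := Measure.sum fun n ↦ (chartArea (c n)).restrict (D n) with hν
  have hνs : ∀ (x₁ : X) (t : Set X), MeasurableSet t → t ⊆ (chartAt Plane x₁).source →
      ν t = chartArea x₁ t := by
    intro x₁ t ht ht'
    have hsum : chartArea x₁ t = ∑' n, chartArea x₁ (t ∩ D n) := by
      rw [← measure_iUnion (fun i j hij ↦ (hDd hij).mono inter_subset_right inter_subset_right)
        (fun n ↦ ht.inter (hDm n)), ← inter_iUnion, hDU, inter_univ]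
    rw [hν, Measure.sum_apply _ ht, hsum]
    refine tsum_congr fun n ↦ ?_
    rw [Measure.restrict_apply ht]
    exact chartArea_eq_of_subset (ht.inter (hDm n)) (inter_subset_left.trans ht')
      (inter_subset_right.trans (hDs n))
  have hle : ∀ x₁ : X, chartArea x₁ ≤ ν := by
    intro x₁
    refine Measure.le_iff.2 fun t ht ↦ ?_
    have hm := (chartAt Plane x₁).open_source.measurableSet
    calc chartArea x₁ t = chartArea x₁ (t ∩ (chartAt Plane x₁).source) :=
          (measure_inter_conull (chartArea_compl_source x₁)).symm
      _ = ν (t ∩ (chartAt Plane x₁).source) :=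
          (hνs x₁ _ (ht.inter hm) inter_subset_right).symm
      _ ≤ ν t := measure_mono inter_subset_left
  refine le_antisymm ?_ (le_iSup (fun x₁ : X ↦ chartArea x₁) x₀ s)
  calc areaMeasure X s ≤ ν s := iSup_le hle s
    _ = chartArea x₀ s := hνs x₀ s hs hs'

lemma areaMeasure_restrict {x₀ : X} {s : Set X} (hs : MeasurableSet s)
    (hs' : s ⊆ (chartAt Plane x₀).source) :
    (areaMeasure X).restrict s = (chartArea x₀).restrict s := by
  ext t ht
  rw [Measure.restrict_apply ht, Measure.restrict_apply ht]
  exact areaMeasure_apply (ht.inter hs) (inter_subset_right.trans hs')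

/-- The area formula for injective differentiable maps of surfaces. -/
theorem areaMeasure_image {f : X → Y}
    {f' : ∀ x, TangentSpace (𝓡 2) x →L[ℝ] TangentSpace (𝓡 2) (f x)} {s : Set X}
    (hs : MeasurableSet s) (hinj : InjOn f s)
    (hf : ∀ x ∈ s, HasMFDerivWithinAt (𝓡 2) (𝓡 2) f s x (f' x))
    (hg : AEMeasurable (fun x ↦ ENNReal.ofReal (absJac (f' x))) ((areaMeasure X).restrict s)) :
    areaMeasure Y (f '' s) = ∫⁻ x in s, ENNReal.ofReal (absJac (f' x)) ∂(areaMeasure X) := by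
  obtain ⟨c, D, hDm, hDs, hDd, hDU⟩ := exists_chart_partition X
  obtain ⟨c', D', hDm', hDs', hDd', hDU'⟩ := exists_chart_partition Y
  have hcont : ContinuousOn f s := fun x hx ↦ (hf x hx).continuousWithinAt
  -- Cut `s` so finely that each piece lies in one chart domain of `X` and is mapped into one chart
  -- domain of `Y`.
  set P : ℕ × ℕ → Set X := fun p ↦ (s ∩ f ⁻¹' D' p.2) ∩ D p.1 with hP
  have hPm : ∀ p, MeasurableSet (P p) := fun p ↦
    (hcont.measurableSet_inter_preimage hs (hDm' p.2)).inter (hDm p.1)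
  have hPs : ∀ p, P p ⊆ s := fun p ↦ inter_subset_left.trans inter_subset_left
  have hPU : ⋃ p, P p = s := by
    refine subset_antisymm (iUnion_subset hPs) fun x hx ↦ ?_
    obtain ⟨n, hn⟩ := mem_iUnion.1 (hDU.symm ▸ mem_univ x)
    obtain ⟨m, hm⟩ := mem_iUnion.1 (hDU'.symm ▸ mem_univ (f x))
    exact mem_iUnion.2 ⟨(n, m), ⟨hx, hm⟩, hn⟩
  have hPd : Pairwise (Function.onFun Disjoint P) := by
    rintro ⟨n, m⟩ ⟨n', m'⟩ hne
    by_cases h : n = n'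
    · subst h
      have hm : m ≠ m' := fun h ↦ hne (by rw [h])
      exact (((hDd' hm).preimage f).mono inter_subset_right inter_subset_right).mono
        inter_subset_left inter_subset_left
    · exact (hDd h).mono inter_subset_right inter_subset_right
  have hpiece : ∀ p, MeasurableSet (f '' P p) ∧ areaMeasure Y (f '' P p) =
      ∫⁻ x in P p, ENNReal.ofReal (absJac (f' x)) ∂(areaMeasure X) := by
    intro p
    have hsrc : P p ⊆ (chartAt Plane (c p.1)).source := inter_subset_right.trans (hDs p.1)
    have hmaps : MapsTo f (P p) (chartAt Plane (c' p.2)).source := fun x hx ↦ hDs' p.2 hx.1.2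
    have hmeas := hg.mono_measure (Measure.restrict_mono (hPs p) le_rfl)
    rw [areaMeasure_restrict (hPm p) hsrc] at hmeas ⊢
    obtain ⟨h1, h2⟩ := chartArea_image (y₀ := c' p.2) (hPm p) hsrc hmaps (hinj.mono (hPs p))
      (fun x hx ↦ (hf x (hPs p hx)).mono (hPs p)) hmeas
    exact ⟨h1, (areaMeasure_apply h1 (image_subset_iff.2 hmaps)).trans h2⟩
  calc areaMeasure Y (f '' s) = areaMeasure Y (⋃ p, f '' P p) := by rw [← image_iUnion, hPU]
    _ = ∑' p, areaMeasure Y (f '' P p) := by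
        refine measure_iUnion (fun p q hpq ↦ ?_) fun p ↦ (hpiece p).1
        rw [Function.onFun, disjoint_left]
        rintro _ ⟨x, hx, rfl⟩ ⟨y, hy, hxy⟩
        rw [hinj (hPs q hy) (hPs p hx) hxy] at hy
        exact disjoint_left.1 (hPd hpq) hx hy
    _ = ∑' p, ∫⁻ x in P p, ENNReal.ofReal (absJac (f' x)) ∂(areaMeasure X) :=
        tsum_congr fun p ↦ (hpiece p).2
    _ = ∫⁻ x in s, ENNReal.ofReal (absJac (f' x)) ∂(areaMeasure X) := by
        rw [← lintegral_iUnion hPm hPd, hPU]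

-- The density of area in a chart is strictly positive, so a null open set would have a
-- Lebesgue-null open image. This is what later turns almost everywhere identities into pointwise
-- ones.
instance isOpenPosMeasure_areaMeasure : (areaMeasure X).IsOpenPosMeasure := by
  refine ⟨fun U hU ⟨x, hx⟩ h0 ↦ ?_⟩
  set V := U ∩ (chartAt Plane x).source with hV
  have hVo : IsOpen V := hU.inter (chartAt Plane x).open_source
  have hVs : V ⊆ (chartAt Plane x).source := inter_subset_right
  have hV0 : areaMeasure X V = 0 := measure_mono_null inter_subset_left h0
  rw [areaMeasure_apply hVo.measurableSet hVs, chartArea_apply hVo.measurableSet hVs] at hV0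
  have himgo : IsOpen (chartAt Plane x '' V) :=
    (chartAt Plane x).isOpen_image_of_subset_source hVo hVs
  have hsub : chartAt Plane x '' V ⊆ (chartAt Plane x).target := by
    rintro _ ⟨y, hy, rfl⟩
    exact (chartAt Plane x).map_source (hVs hy)
  have hm := (((continuousOn_absJac_coordFrame_symm x).mono hsub).aemeasurable
    (μ := volume) himgo.measurableSet).ennreal_ofReal
  rw [lintegral_eq_zero_iff' hm] at hV0
  have hfalse : ∀ᵐ u ∂(volume : Measure Plane).restrict (chartAt Plane x '' V), False := by
    filter_upwards [hV0, ae_restrict_mem himgo.measurableSet] with u hu hu'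
    have := absJac_coordFrame_pos ((chartAt Plane x).map_target (hsub hu'))
    simp only [Pi.zero_apply, ENNReal.ofReal_eq_zero] at hu
    exact absurd hu (not_le.2 this)
  have hvol : (volume : Measure Plane) (chartAt Plane x '' V) = 0 := by
    simpa [ae_iff] using hfalse
  exact (himgo.measure_pos volume ⟨_, x, ⟨hx, mem_chart_source Plane x⟩, rfl⟩).ne' hvol

end Gluing

end AreaMeasure

/-! ### Domains with Lipschitz boundary: tangent directions, density of the interior, measurability
-/

section LipschitzBoundary

lemma uniqueDiffWithinAt_epigraph {K : NNReal} {f : ℝ → ℝ} (hf : LipschitzWith K f) {u : Plane}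
    (hu : f (u 0) ≤ u 1) : UniqueDiffWithinAt ℝ {v : Plane | f (v 0) ≤ v 1} u := by
  -- The upward cone of slope `K` with apex `u`: the Lipschitz bound keeps it inside the epigraph,
  -- and it is convex with nonempty interior.
  set C : Set Plane := {v | K * |v 0 - u 0| ≤ v 1 - u 1} with hC
  have hsub : C ⊆ {v : Plane | f (v 0) ≤ v 1} := by
    intro v hv
    have h := hf.dist_le_mul (v 0) (u 0)
    rw [Real.dist_eq, Real.dist_eq] at h
    have h' := (abs_le.1 h).2
    simp only [hC, mem_ofPred_eq] at hv ⊢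
    linarith
  have hconv : Convex ℝ C := by
    intro v hv w hw a b ha hb hab
    simp only [hC, mem_ofPred_eq, PiLp.add_apply, PiLp.smul_apply, smul_eq_mul] at hv hw ⊢
    have h0 : a * v 0 + b * w 0 - u 0 = a * (v 0 - u 0) + b * (w 0 - u 0) := by
      linear_combination u 0 * hab
    have h1 : a * v 1 + b * w 1 - u 1 = a * (v 1 - u 1) + b * (w 1 - u 1) := by
      linear_combination u 1 * hab
    rw [h0, h1]
    have h2 := abs_add_le (a * (v 0 - u 0)) (b * (w 0 - u 0))
    rw [abs_mul, abs_mul, abs_of_nonneg ha, abs_of_nonneg hb] at h2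
    have h3 := mul_le_mul_of_nonneg_left h2 K.coe_nonneg
    nlinarith [mul_le_mul_of_nonneg_left hv ha, mul_le_mul_of_nonneg_left hw hb]
  have hint : (interior C).Nonempty := by
    have ho : IsOpen {v : Plane | K * |v 0 - u 0| < v 1 - u 1} :=
      isOpen_lt (by fun_prop) (by fun_prop)
    refine ⟨u + EuclideanSpace.single 1 (1 : ℝ), interior_maximal ?_ ho ?_⟩
    · intro v hv
      simp only [hC, mem_ofPred_eq] at hv ⊢
      exact hv.le
    · simp
  exact ((uniqueDiffOn_convex hconv hint) u (by simp [hC])).mono hsub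

variable {X : Type*} [TopologicalSpace X] [ChartedSpace Plane X] {M : Set X}

/-- Transports the cone argument through the chart. It makes differentials along `M` unique at
boundary points too, which the chain rule for `differential` requires. -/
lemma HasLipschitzBoundary.uniqueMDiffOn [IsManifold (𝓡 2) ∞ X] (hM : HasLipschitzBoundary M) :
    UniqueMDiffOn (𝓡 2) M := by
  intro x hx
  obtain ⟨e, he, hxe, h | ⟨K, f, hf, h⟩⟩ := hM x hx
  · exact (e.open_source.uniqueMDiffWithinAt hxe).mono h
  · have hu : UniqueMDiffWithinAt (𝓡 2) {v : Plane | f (v 0) ≤ v 1} (e x) :=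
      (uniqueDiffWithinAt_epigraph hf ((h x hxe).1 hx)).uniqueMDiffWithinAt
    have he1 : e ∈ IsManifold.maximalAtlas (𝓡 2) 1 X :=
      IsManifold.maximalAtlas_subset_of_le (by exact_mod_cast le_top) he
    have := IsManifold.of_le (I := 𝓡 2) (M := X) (m := 1) (n := ∞) (by exact_mod_cast le_top)
    have hd : e.MDifferentiable (𝓡 2) (𝓡 2) :=
      ⟨fun y hy ↦ (mdifferentiableAt_of_mem_maximalAtlas he1 hy).mdifferentiableWithinAt,
        fun y hy ↦ (mdifferentiableAt_symm_of_mem_maximalAtlas he1 hy).mdifferentiableWithinAt⟩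
    have h1 := hu.preimage_openPartialHomeomorph hd.symm (e.map_source hxe)
    rw [e.left_inv hxe] at h1
    exact h1.mono fun y hy ↦ (h y hy.1).2 hy.2

lemma HasLipschitzBoundary.subset_closure_interior (hM : HasLipschitzBoundary M) :
    M ⊆ closure (interior M) := by
  intro x hx
  obtain ⟨e, -, hxe, h | ⟨K, f, hf, h⟩⟩ := hM x hx
  · exact subset_closure (interior_maximal h e.open_source hxe)
  · have hU : IsOpen (e.source ∩ e ⁻¹' {v : Plane | f (v 0) < v 1}) := by
      have := hf.continuous
      exact e.isOpen_inter_preimage (isOpen_lt (by fun_prop) (by fun_prop))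
    have hUM : e.source ∩ e ⁻¹' {v : Plane | f (v 0) < v 1} ⊆ interior M :=
      interior_maximal (fun y hy ↦ (h y hy.1).2 (le_of_lt hy.2)) hU
    refine closure_mono hUM ?_
    -- Moving straight up from a point of the epigraph enters the strict epigraph at once.
    set γ : ℝ → Plane := fun t ↦ e x + EuclideanSpace.single 1 t with hγ
    have hγc : ContinuousAt γ 0 := by
      have : Continuous fun t : ℝ ↦ (EuclideanSpace.single 1 t : Plane) := by
        have h : (fun t : ℝ ↦ (EuclideanSpace.single 1 t : Plane)) =
            fun t ↦ t • (EuclideanSpace.single 1 (1 : ℝ) : Plane) := by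
          ext t i; simp
        rw [h]; fun_prop
      exact (continuous_const.add this).continuousAt
    have hγ0 : γ 0 = e x := by simp [hγ]
    have htend : Tendsto γ (𝓝[>] 0) (𝓝 (e x)) := by
      rw [← hγ0]; exact hγc.tendsto.mono_left nhdsWithin_le_nhds
    have hsymm : Tendsto (fun t ↦ e.symm (γ t)) (𝓝[>] 0) (𝓝 x) :=
      (e.tendsto_symm hxe).comp htend
    refine mem_closure_of_tendsto hsymm ?_
    filter_upwards [htend (e.open_target.mem_nhds (e.map_source hxe)), self_mem_nhdsWithin]
      with t ht ht0
    refine ⟨e.map_target ht, ?_⟩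
    rw [mem_preimage, e.right_inv ht]
    have h1 := (h x hxe).1 hx
    simp only [hγ, mem_ofPred_eq, PiLp.add_apply, PiLp.single_apply]
    simp only [mem_Ioi] at ht0
    simp
    linarith

/-- Near each of its points `M` is relatively closed in a chart domain, or all of it; countably many
such neighbourhoods cover `M`. -/
lemma HasLipschitzBoundary.measurableSet [SecondCountableTopology X] [MeasurableSpace X]
    [BorelSpace X] (hM : HasLipschitzBoundary M) : MeasurableSet M := by
  have hloc : ∀ x : X, x ∈ M → ∃ U : Set X, U ∈ 𝓝 x ∧ MeasurableSet (U ∩ M) := by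
    intro x hx
    obtain ⟨e, -, hxe, h | ⟨K, f, hf, h⟩⟩ := hM x hx
    · refine ⟨e.source, e.open_source.mem_nhds hxe, ?_⟩
      rw [inter_eq_left.2 h]
      exact e.open_source.measurableSet
    · refine ⟨e.source, e.open_source.mem_nhds hxe, ?_⟩
      have := hf.continuous
      have hc : IsClosed {v : Plane | f (v 0) ≤ v 1} := isClosed_le (by fun_prop) (by fun_prop)
      convert e.continuousOn.measurableSet_inter_preimage e.open_source.measurableSet
        hc.measurableSet using 1
      ext y
      exact ⟨fun hy ↦ ⟨hy.1, (h y hy.1).1 hy.2⟩, fun hy ↦ ⟨hy.1, (h y hy.1).2 hy.2⟩⟩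
  choose! U hU hUm using hloc
  obtain ⟨t, htM, htc, ht⟩ := TopologicalSpace.countable_cover_nhdsWithin
    (s := M) (f := U) fun x hx ↦ mem_nhdsWithin_of_mem_nhds (hU x hx)
  have : M = ⋃ x ∈ t, U x ∩ M := by
    rw [← iUnion₂_inter, inter_eq_right.2 ht]
  rw [this]
  exact MeasurableSet.biUnion htc fun x hx ↦ hUm x (htM hx)

end LipschitzBoundary

/-! ### Bijections of subsets as maps of the ambient surfaces -/

section AmbientMaps

variable {X : Type*} {Y : Type*} [Nonempty Y] {Z : Type*} [Nonempty Z]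
  {M : Set X} {N : Set Y} {P : Set Z}

lemma ambient_apply (φ : M ≃ N) {x : X} (hx : x ∈ M) : ambient φ x = φ ⟨x, hx⟩ :=
  Subtype.val_injective.extend_apply (fun x ↦ (φ x : Y)) _ (⟨x, hx⟩ : M)

lemma mapsTo_ambient (φ : M ≃ N) : MapsTo (ambient φ) M N := fun x hx ↦ by
  rw [ambient_apply φ hx]; exact (φ ⟨x, hx⟩).2

lemma ambient_trans (φ : M ≃ N) (ψ : N ≃ P) {x : X} (hx : x ∈ M) :
    ambient (φ.trans ψ) x = ambient ψ (ambient φ x) := by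
  rw [ambient_apply _ hx, ambient_apply ψ (mapsTo_ambient φ hx)]
  simp [ambient_apply φ hx]

lemma ambient_refl [Nonempty X] {x : X} (hx : x ∈ M) : ambient (Equiv.refl M) x = x :=
  ambient_apply _ hx

lemma ambient_symm_ambient [Nonempty X] (φ : M ≃ N) {x : X} (hx : x ∈ M) :
    ambient φ.symm (ambient φ x) = x := by
  rw [← ambient_trans φ φ.symm hx, Equiv.self_trans_symm, ambient_refl hx]

lemma injOn_ambient (φ : M ≃ N) : InjOn (ambient φ) M := fun x hx y hy h ↦ by
  rw [ambient_apply φ hx, ambient_apply φ hy] at h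
  simpa using φ.injective (Subtype.ext h)

lemma image_ambient (φ : M ≃ N) : ambient φ '' M = N := by
  refine subset_antisymm (image_subset_iff.2 (mapsTo_ambient φ)) fun y hy ↦ ?_
  refine ⟨φ.symm ⟨y, hy⟩, (φ.symm ⟨y, hy⟩).2, ?_⟩
  rw [ambient_apply φ (φ.symm ⟨y, hy⟩).2]
  simp

end AmbientMaps

/-! ### Chain rule, Jacobians, homotheties and equivalence classes -/

section Differential

variable {X : Type*} [TopologicalSpace X] [ChartedSpace Plane X]
  {Y : Type*} [TopologicalSpace Y] [ChartedSpace Plane Y]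
  {Z : Type*} [TopologicalSpace Z] [ChartedSpace Plane Z]

/-- The two differentials have targets over points that are only propositionally equal. Pairing each
with its base point gives an honest equation, from which Jacobians, inner products and singular
values transfer by `congrArg`. -/
lemma sigma_mfderiv_eq {f g : X → Y} {s : Set X} {x : X}
    {f' : TangentSpace (𝓡 2) x →L[ℝ] TangentSpace (𝓡 2) (f x)}
    {g' : TangentSpace (𝓡 2) x →L[ℝ] TangentSpace (𝓡 2) (g x)}
    (hs : UniqueMDiffWithinAt (𝓡 2) s x) (hx : x ∈ s) (hfg : EqOn f g s)
    (hf : HasMFDerivWithinAt (𝓡 2) (𝓡 2) f s x f')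
    (hg : HasMFDerivWithinAt (𝓡 2) (𝓡 2) g s x g') :
    (⟨f x, f'⟩ : Σ y : Y, TangentSpace (𝓡 2) x →L[ℝ] TangentSpace (𝓡 2) y) = ⟨g x, g'⟩ := by
  have h : HasMFDerivWithinAt (𝓡 2) (𝓡 2) f s x
      (show TangentSpace (𝓡 2) x →L[ℝ] TangentSpace (𝓡 2) (f x) from g') :=
    hg.congr_of_eventuallyEq (hfg.eventuallyEq_of_mem self_mem_nhdsWithin) (hfg hx)
  have h' := hs.eq hf h
  refine Sigma.ext (hfg hx) ?_
  exact heq_of_eq h'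

variable [IsManifold (𝓡 2) ∞ X] [RiemannianBundle (fun x : X ↦ TangentSpace (𝓡 2) x)] [Nonempty X]
  [IsManifold (𝓡 2) ∞ Y] [RiemannianBundle (fun y : Y ↦ TangentSpace (𝓡 2) y)] [Nonempty Y]
  [IsManifold (𝓡 2) ∞ Z] [RiemannianBundle (fun z : Z ↦ TangentSpace (𝓡 2) z)] [Nonempty Z]
  {M : Set X} {N : Set Y} {P : Set Z}

lemma IsSmoothDiffeo.hasMFDerivWithinAt {φ : M ≃ N} (hφ : IsSmoothDiffeo φ) {x : X} (hx : x ∈ M) :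
    HasMFDerivWithinAt (𝓡 2) (𝓡 2) (ambient φ) M x (differential φ x) :=
  ((hφ.1 x hx).mdifferentiableWithinAt (by simp)).hasMFDerivWithinAt

lemma IsSmoothDiffeo.trans {φ : M ≃ N} {ψ : N ≃ P} (hφ : IsSmoothDiffeo φ)
    (hψ : IsSmoothDiffeo ψ) : IsSmoothDiffeo (φ.trans ψ) :=
  ⟨(hψ.1.comp hφ.1 (mapsTo_ambient φ)).congr fun _ hx ↦ ambient_trans φ ψ hx,
    (hφ.2.comp hψ.2 (mapsTo_ambient ψ.symm)).congr fun _ hx ↦ ambient_trans ψ.symm φ.symm hx⟩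

lemma IsSmoothDiffeo.symm {φ : M ≃ N} (hφ : IsSmoothDiffeo φ) : IsSmoothDiffeo φ.symm :=
  ⟨hφ.2, hφ.1⟩

lemma IsSmoothDiffeo.differential_trans (hM : UniqueMDiffOn (𝓡 2) M) {φ : M ≃ N} {ψ : N ≃ P}
    (hφ : IsSmoothDiffeo φ) (hψ : IsSmoothDiffeo ψ) {x : X} (hx : x ∈ M) :
    (⟨ambient (φ.trans ψ) x, differential (φ.trans ψ) x⟩ :
        Σ z : Z, TangentSpace (𝓡 2) x →L[ℝ] TangentSpace (𝓡 2) z) =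
      ⟨ambient ψ (ambient φ x), differential ψ (ambient φ x) ∘L differential φ x⟩ :=
  sigma_mfderiv_eq (hM x hx) hx (fun _ hy ↦ ambient_trans φ ψ hy)
    ((hφ.trans hψ).hasMFDerivWithinAt hx)
    ((hψ.hasMFDerivWithinAt (mapsTo_ambient φ hx)).comp x (hφ.hasMFDerivWithinAt hx)
      (mapsTo_ambient φ))

lemma differential_refl (hM : UniqueMDiffOn (𝓡 2) M) {x : X} (hx : x ∈ M) :
    (⟨ambient (Equiv.refl M) x, differential (Equiv.refl M) x⟩ :
        Σ y : X, TangentSpace (𝓡 2) x →L[ℝ] TangentSpace (𝓡 2) y) =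
      ⟨x, ContinuousLinearMap.id ℝ _⟩ := by
  have hs : ContMDiffOn (𝓡 2) (𝓡 2) ∞ (ambient (Equiv.refl M)) M :=
    contMDiffOn_id.congr fun y hy ↦ ambient_refl hy
  have hr : IsSmoothDiffeo (Equiv.refl M) := ⟨hs, hs⟩
  exact sigma_mfderiv_eq (hM x hx) hx (fun _ hy ↦ ambient_refl hy)
    (hr.hasMFDerivWithinAt hx) (hasMFDerivWithinAt_id M x)

/-- The oriented Jacobian of `φ : M ≃ N` at a point. -/
def jacobian (oX : SurfaceOrientation X) (oY : SurfaceOrientation Y) (φ : M ≃ N) (x : X) : ℝ :=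
  linJac (oX.orient x) (oY.orient (ambient φ x)) (differential φ x)

variable {oX : SurfaceOrientation X} {oY : SurfaceOrientation Y} {oZ : SurfaceOrientation Z}

lemma mem_Diff_iff {φ : M ≃ N} :
    φ ∈ Diff oX oY M N ↔ IsSmoothDiffeo φ ∧ ∀ x ∈ M, 0 < jacobian oX oY φ x := by
  simp only [Diff, mem_ofPred_eq, linOrientationPreserving_iff, jacobian]

lemma isAreaPreserving_iff {φ : M ≃ N} :
    IsAreaPreserving oX oY φ ↔ ∀ x ∈ M, jacobian oX oY φ x = 1 := by
  simp only [IsAreaPreserving, linAreaPreserving_iff, jacobian]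

lemma jacobian_trans (hM : UniqueMDiffOn (𝓡 2) M) {φ : M ≃ N} {ψ : N ≃ P}
    (hφ : IsSmoothDiffeo φ) (hψ : IsSmoothDiffeo ψ) {x : X} (hx : x ∈ M) :
    jacobian oX oZ (φ.trans ψ) x = jacobian oY oZ ψ (ambient φ x) * jacobian oX oY φ x := by
  have h := congrArg (fun p : Σ z : Z, TangentSpace (𝓡 2) x →L[ℝ] TangentSpace (𝓡 2) z ↦
    linJac (oX.orient x) (oZ.orient p.1) p.2) (hφ.differential_trans hM hψ hx)
  exact h.trans (linJac_comp _ _ _ _ _)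

lemma jacobian_refl (hM : UniqueMDiffOn (𝓡 2) M) {x : X} (hx : x ∈ M) :
    jacobian oX oX (Equiv.refl M) x = 1 := by
  have h := congrArg (fun p : Σ z : X, TangentSpace (𝓡 2) x →L[ℝ] TangentSpace (𝓡 2) z ↦
    linJac (oX.orient x) (oX.orient p.1) p.2) (differential_refl hM hx)
  exact h.trans (linJac_id _)

lemma ScalesMetric.trans (hM : UniqueMDiffOn (𝓡 2) M) {φ : M ≃ N} {ψ : N ≃ P}
    (hφ : IsSmoothDiffeo φ) (hψ : IsSmoothDiffeo ψ) {c d : ℝ} (hc : ScalesMetric c φ)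
    (hd : ScalesMetric d ψ) : ScalesMetric (d * c) (φ.trans ψ) := by
  intro x hx v w
  have h := congrArg (fun p : Σ z : Z, TangentSpace (𝓡 2) x →L[ℝ] TangentSpace (𝓡 2) z ↦
    (inner ℝ (p.2 v) (p.2 w) : ℝ)) (hφ.differential_trans hM hψ hx)
  refine h.trans ?_
  simp only [ContinuousLinearMap.comp_apply]
  rw [hd _ (mapsTo_ambient φ hx), hc x hx]
  ring

lemma ScalesMetric.singularValueSum_trans (hM : UniqueMDiffOn (𝓡 2) M) {φ : M ≃ N} {ψ : N ≃ P}
    (hφ : IsSmoothDiffeo φ) (hψ : IsSmoothDiffeo ψ) {c : ℝ} (hc : 0 ≤ c) (hψc : ScalesMetric c ψ)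
    {x : X} (hx : x ∈ M) : singularValueSum (differential (φ.trans ψ) x) =
      c * singularValueSum (differential φ x) := by
  have h := congrArg (fun p : Σ z : Z, TangentSpace (𝓡 2) x →L[ℝ] TangentSpace (𝓡 2) z ↦
    singularValueSum p.2) (hφ.differential_trans hM hψ hx)
  exact h.trans (singularValueSum_comp_of_scales hc (hψc _ (mapsTo_ambient φ hx)) _)

lemma ScalesMetric.jacobian_eq {φ : M ≃ N} (hφ : φ ∈ Diff oX oY M N) {c : ℝ}
    (hc : ScalesMetric c φ) {x : X} (hx : x ∈ M) : jacobian oX oY φ x = c ^ 2 :=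
  linJac_of_scales _ _ (hc x hx) (hφ.2 x hx)

lemma Diff_trans (hM : UniqueMDiffOn (𝓡 2) M) {φ : M ≃ N} {ψ : N ≃ P} (hφ : φ ∈ Diff oX oY M N)
    (hψ : ψ ∈ Diff oY oZ N P) : φ.trans ψ ∈ Diff oX oZ M P := by
  rw [mem_Diff_iff] at hφ hψ ⊢
  refine ⟨hφ.1.trans hψ.1, fun x hx ↦ ?_⟩
  rw [jacobian_trans (oY := oY) hM hφ.1 hψ.1 hx]
  exact mul_pos (hψ.2 _ (mapsTo_ambient φ hx)) (hφ.2 x hx)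

lemma jacobian_symm_mul (hM : UniqueMDiffOn (𝓡 2) M) {φ : M ≃ N} (hφ : IsSmoothDiffeo φ)
    {x : X} (hx : x ∈ M) :
    jacobian oY oX φ.symm (ambient φ x) * jacobian oX oY φ x = 1 := by
  rw [← jacobian_trans hM hφ hφ.symm hx, Equiv.self_trans_symm, jacobian_refl hM hx]

lemma Diff_symm (hM : UniqueMDiffOn (𝓡 2) M) {φ : M ≃ N} (hφ : φ ∈ Diff oX oY M N) :
    φ.symm ∈ Diff oY oX N M := by
  rw [mem_Diff_iff] at hφ ⊢
  refine ⟨hφ.1.symm, fun y hy ↦ ?_⟩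
  have hx := mapsTo_ambient φ.symm hy
  have h := jacobian_symm_mul (oX := oX) (oY := oY) hM hφ.1 hx
  have hφx := hφ.2 _ hx
  rw [show ambient φ (ambient φ.symm y) = y from ambient_symm_ambient φ.symm hy] at h
  by_contra hneg
  nlinarith [mul_nonneg (neg_nonneg.2 (not_lt.1 hneg)) hφx.le]

lemma ScalesMetric.symm (hN : UniqueMDiffOn (𝓡 2) N) {φ : M ≃ N} (hφ : IsSmoothDiffeo φ) {c : ℝ}
    (hc0 : c ≠ 0) (hc : ScalesMetric c φ) : ScalesMetric c⁻¹ φ.symm := by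
  intro y hy v w
  have hs := (hφ.symm.differential_trans hN hφ hy).symm
  have hr : (⟨ambient (φ.symm.trans φ) y, differential (φ.symm.trans φ) y⟩ :
        Σ z : Y, TangentSpace (𝓡 2) y →L[ℝ] TangentSpace (𝓡 2) z) =
      ⟨y, ContinuousLinearMap.id ℝ _⟩ := by
    rw [Equiv.symm_trans_self]
    exact differential_refl hN hy
  have h := congrArg (fun p : Σ z : Y, TangentSpace (𝓡 2) y →L[ℝ] TangentSpace (𝓡 2) z ↦
    (inner ℝ (p.2 v) (p.2 w) : ℝ)) (hs.trans hr)
  simp only [ContinuousLinearMap.comp_apply, ContinuousLinearMap.id_apply] at h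
  rw [hc _ (mapsTo_ambient φ.symm hy)] at h
  rw [← h]
  field_simp

/-- Conjugating by a homothety preserves isometries. -/
lemma IsRiemannianIsometry.conj (hM : UniqueMDiffOn (𝓡 2) M) (hN : UniqueMDiffOn (𝓡 2) N)
    {ψ : M ≃ N} (hψ : IsSmoothDiffeo ψ) {c : ℝ} (hc0 : c ≠ 0) (hc : ScalesMetric c ψ)
    {S : N ≃ N} (hS : IsRiemannianIsometry S) :
    IsRiemannianIsometry ((ψ.trans S).trans ψ.symm) := by
  refine ⟨(hψ.trans hS.1).trans hψ.symm, ?_⟩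
  have h := (hc.trans hM hψ hS.1 hS.2).trans hM (hψ.trans hS.1) hψ.symm (hc.symm hN hψ hc0)
  rwa [one_mul, inv_mul_cancel₀ hc0] at h

/-- The isometry `T` of the source is kept, while the isometry `S` of the target is conjugated by
`ψ`; the scaling factors of `ψ` and its inverse cancel. -/
lemma equivalent_pullBack_iff (hM : UniqueMDiffOn (𝓡 2) M) (hN : UniqueMDiffOn (𝓡 2) N)
    {ψ : M ≃ N} (hψ : IsSmoothDiffeo ψ) {c : ℝ} (hc0 : c ≠ 0) (hc : ScalesMetric c ψ)
    {φ φ' : M ≃ N} : Equivalent (pullBack ψ φ') (pullBack ψ φ) ↔ Equivalent φ' φ := by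
  constructor
  · rintro ⟨T, S, hT, hS, h⟩
    refine ⟨T, (ψ.symm.trans S).trans ψ, hT,
      hS.conj hN hM hψ.symm (inv_ne_zero hc0) (hc.symm hN hψ hc0), ?_⟩
    ext x
    have := congrArg (fun e : M ≃ M ↦ ψ (e x)) h
    simpa [pullBack] using congrArg Subtype.val this
  · rintro ⟨T, S, hT, hS, rfl⟩
    refine ⟨T, (ψ.trans S).trans ψ.symm, hT, hS.conj hM hN hψ hc0 hc, ?_⟩
    ext x
    simp [pullBack]

lemma pullBack_mem_Diff_iff (hM : UniqueMDiffOn (𝓡 2) M)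
    {ψ φ : M ≃ N} (hψ : ψ ∈ Diff oX oY M N) :
    pullBack ψ φ ∈ Diff oX oX M M ↔ φ ∈ Diff oX oY M N := by
  constructor
  · intro h
    have h' := Diff_trans hM h hψ
    rwa [pullBack, Equiv.trans_assoc, Equiv.symm_trans_self, Equiv.trans_refl] at h'
  · exact fun h ↦ Diff_trans hM h (Diff_symm hM hψ)

lemma pullBack_trans_self (ψ : M ≃ N) (χ : M ≃ M) : pullBack ψ (χ.trans ψ) = χ := by
  ext x; simp [pullBack]

/-- `pullBack ψ` is a bijection that respects membership in `Diff` and equivalence in both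
directions, so it carries each class exactly onto a class. -/
lemma bijOn_equivalenceClasses (hM : UniqueMDiffOn (𝓡 2) M) (hN : UniqueMDiffOn (𝓡 2) N)
    {ψ : M ≃ N} (hψ : ψ ∈ Diff oX oY M N) {c : ℝ} (hc0 : c ≠ 0) (hc : ScalesMetric c ψ)
    {A : Set (M ≃ N)} {B : Set (M ≃ M)} (hAB : ∀ φ, φ ∈ A ↔ pullBack ψ φ ∈ B) :
    BijOn (fun C ↦ pullBack ψ '' C) (equivalenceClasses oX oY A) (equivalenceClasses oX oX B) := by
  have himg : ∀ φ : M ≃ N, pullBack ψ '' {φ' | φ' ∈ Diff oX oY M N ∧ Equivalent φ' φ} =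
      {χ | χ ∈ Diff oX oX M M ∧ Equivalent χ (pullBack ψ φ)} := by
    intro φ
    ext χ
    constructor
    · rintro ⟨φ', ⟨h1, h2⟩, rfl⟩
      exact ⟨(pullBack_mem_Diff_iff hM hψ).2 h1,
        (equivalent_pullBack_iff hM hN hψ.1 hc0 hc).2 h2⟩
    · rintro ⟨h1, h2⟩
      rw [← pullBack_trans_self ψ χ] at h1 h2
      exact ⟨χ.trans ψ, ⟨(pullBack_mem_Diff_iff hM hψ).1 h1,
        (equivalent_pullBack_iff hM hN hψ.1 hc0 hc).1 h2⟩, pullBack_trans_self ψ χ⟩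
  have hinj : Function.Injective (pullBack ψ) := fun φ φ' h ↦ by
    ext x
    have := congrArg (fun e : M ≃ M ↦ (ψ (e x) : Y)) h
    simpa [pullBack] using this
  refine ⟨?_, hinj.image_injective.injOn, ?_⟩
  · rintro _ ⟨φ, hφ, rfl⟩
    exact ⟨pullBack ψ φ, (hAB φ).1 hφ, himg φ⟩
  · rintro _ ⟨χ, hχ, rfl⟩
    rw [← pullBack_trans_self ψ χ] at hχ ⊢
    exact ⟨_, ⟨χ.trans ψ, (hAB _).2 hχ, rfl⟩, himg _⟩

end Differential

/-! ### Continuity up to the boundary of the Jacobian and the singular value sum -/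

section ContinuityOfDifferential

variable {X : Type*} [TopologicalSpace X] [ChartedSpace Plane X] [IsManifold (𝓡 2) ∞ X]
  [RiemannianBundle (fun x : X ↦ TangentSpace (𝓡 2) x)] [Nonempty X]
  [IsContMDiffRiemannianBundle (𝓡 2) ∞ Plane (fun x : X ↦ TangentSpace (𝓡 2) x)]
  {Y : Type*} [TopologicalSpace Y] [ChartedSpace Plane Y] [IsManifold (𝓡 2) ∞ Y]
  [RiemannianBundle (fun y : Y ↦ TangentSpace (𝓡 2) y)] [Nonempty Y]
  [IsContMDiffRiemannianBundle (𝓡 2) ∞ Plane (fun y : Y ↦ TangentSpace (𝓡 2) y)]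
  {M : Set X} {N : Set Y} {oX : SurfaceOrientation X} {oY : SurfaceOrientation Y}

lemma continuousOn_inner_differential_coordVec (hM : UniqueMDiffOn (𝓡 2) M) {φ : M ≃ N}
    (hφ : IsSmoothDiffeo φ) (x₀ : X) (i j : Fin 2) :
    ContinuousOn (fun x ↦ (inner ℝ (differential φ x (coordVec x₀ i x))
      (differential φ x (coordVec x₀ j x)) : ℝ)) (M ∩ (chartAt Plane x₀).source) := by
  have := isManifold_one X
  have := isManifold_one Y
  have := isContinuousRiemannianBundle Y
  have h : ∀ i, ContinuousOn (fun x ↦ (⟨ambient φ x, differential φ x (coordVec x₀ i x)⟩ :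
      TangentBundle (𝓡 2) Y)) (M ∩ (chartAt Plane x₀).source) := by
    intro i
    have h1 := hφ.1.continuousOn_tangentMapWithin (by simp) hM
    exact h1.comp ((continuousOn_coordVec x₀ i).mono inter_subset_right) fun x hx ↦ hx.1
  exact (h i).inner_bundle (h j)

lemma areaForm_coordVec_sq (oX : SurfaceOrientation X) (x₀ x : X) :
    (oX.orient x).areaForm (coordVec x₀ 0 x) (coordVec x₀ 1 x) ^ 2 =
      inner ℝ (coordVec x₀ 0 x) (coordVec x₀ 0 x) * inner ℝ (coordVec x₀ 1 x) (coordVec x₀ 1 x) -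
        inner ℝ (coordVec x₀ 0 x) (coordVec x₀ 1 x) ^ 2 := by
  rw [← gram_det_eq_areaForm_sq, real_inner_self_eq_norm_sq, real_inner_self_eq_norm_sq]

lemma areaForm_coordVec_sq_pos (oX : SurfaceOrientation X) {x₀ x : X}
    (hx : x ∈ (chartAt Plane x₀).source) :
    0 < (oX.orient x).areaForm (coordVec x₀ 0 x) (coordVec x₀ 1 x) ^ 2 := by
  have h := absJac_coordFrame_pos hx
  rw [← sqrt_det_gramMatrix, Real.sqrt_pos, Matrix.det_fin_two] at h
  simp only [gramMatrix, Matrix.of_apply] at h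
  rw [areaForm_coordVec_sq]
  rw [real_inner_comm (coordVec x₀ 0 x) (coordVec x₀ 1 x), ← sq] at h
  exact h

lemma continuousOn_areaForm_coordVec_sq (oX : SurfaceOrientation X) (x₀ : X) :
    ContinuousOn (fun x ↦ (oX.orient x).areaForm (coordVec x₀ 0 x) (coordVec x₀ 1 x) ^ 2)
      (chartAt Plane x₀).source := by
  simp only [areaForm_coordVec_sq]
  exact ((continuousOn_inner_coordVec x₀ 0 0).mul (continuousOn_inner_coordVec x₀ 1 1)).sub
    ((continuousOn_inner_coordVec x₀ 0 1).pow 2)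

omit [ChartedSpace Plane Y] [IsManifold (𝓡 2) ∞ Y] [IsManifold (𝓡 2) ∞ X]
  [RiemannianBundle (fun x : X ↦ TangentSpace (𝓡 2) x)] [Nonempty X] [Nonempty Y]
  [IsContMDiffRiemannianBundle (𝓡 2) ∞ Plane (fun x : X ↦ TangentSpace (𝓡 2) x)] in
lemma continuousOn_of_inter_chart_source {f : X → Y}
    (h : ∀ x₀ : X, ContinuousOn f (M ∩ (chartAt Plane x₀).source)) : ContinuousOn f M := by
  intro x hx
  exact (continuousWithinAt_inter ((chartAt Plane x).open_source.mem_nhds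
    (mem_chart_source Plane x))).1 (h x x ⟨hx, mem_chart_source Plane x⟩)

/-- Orthonormal bases of the tangent planes need not vary continuously, so the norm is expressed
through the coordinate frame. There it is a quotient of continuous inner products by a positive Gram
determinant. -/
lemma continuousOn_frobeniusNorm_sq (oX : SurfaceOrientation X) (hM : UniqueMDiffOn (𝓡 2) M)
    {φ : M ≃ N} (hφ : IsSmoothDiffeo φ) :
    ContinuousOn (fun x ↦ frobeniusNorm (differential φ x) ^ 2) M := by
  refine continuousOn_of_inter_chart_source fun x₀ ↦ ?_
  have ha := fun i j ↦ continuousOn_inner_differential_coordVec hM hφ x₀ i j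
  have hg := fun i j ↦ (continuousOn_inner_coordVec x₀ i j).mono
    (inter_subset_right (s := M) (t := (chartAt Plane x₀).source))
  have hd := (continuousOn_areaForm_coordVec_sq oX x₀).mono
    (inter_subset_right (s := M) (t := (chartAt Plane x₀).source))
  have hc := ((((ha 0 0).mul (hg 1 1)).sub ((continuousOn_const (c := (2 : ℝ))).mul
    ((ha 0 1).mul (hg 0 1)))).add ((ha 1 1).mul (hg 0 0))).div hd
    fun x hx ↦ (areaForm_coordVec_sq_pos oX hx.2).ne'
  refine hc.congr fun x hx ↦ ?_
  have h := frobeniusNorm_sq_mul_areaForm_sq (oX.orient x) (differential φ x)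
    (coordVec x₀ 0 x) (coordVec x₀ 1 x)
  simp only [Pi.div_apply, Pi.add_apply, Pi.sub_apply, Pi.mul_apply]
  rw [eq_div_iff (areaForm_coordVec_sq_pos oX hx.2).ne', h]
  simp only [real_inner_self_eq_norm_sq]
  ring

/-- The squared Jacobian is a quotient of Gram determinants, in which the signs of the orientations
drop out; positivity on `Diff` selects the positive root. -/
lemma continuousOn_jacobian (hM : UniqueMDiffOn (𝓡 2) M) {φ : M ≃ N} (hφ : φ ∈ Diff oX oY M N) :
    ContinuousOn (jacobian oX oY φ) M := by
  refine continuousOn_of_inter_chart_source fun x₀ ↦ ?_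
  have ha := fun i j ↦ continuousOn_inner_differential_coordVec hM hφ.1 x₀ i j
  have hd := (continuousOn_areaForm_coordVec_sq oX x₀).mono
    (inter_subset_right (s := M) (t := (chartAt Plane x₀).source))
  have hc := ((((ha 0 0).mul (ha 1 1)).sub ((ha 0 1).pow 2)).div hd
    fun x hx ↦ (areaForm_coordVec_sq_pos oX hx.2).ne').sqrt
  refine hc.congr fun x hx ↦ ?_
  have h := areaForm_map_map (oX.orient x) (oY.orient (ambient φ x)) (differential φ x)
    (coordVec x₀ 0 x) (coordVec x₀ 1 x)
  have h2 := congrArg (· ^ 2) h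
  simp only [mul_pow, ← gram_det_eq_areaForm_sq (oV := oY.orient (ambient φ x)),
    ← real_inner_self_eq_norm_sq] at h2
  have hJ : 0 ≤ jacobian oX oY φ x := ((mem_Diff_iff.1 hφ).2 x hx.1).le
  simp only [Pi.div_apply, Pi.sub_apply, Pi.mul_apply, Pi.pow_apply]
  rw [h2, mul_div_assoc, div_self (areaForm_coordVec_sq_pos oX hx.2).ne', mul_one]
  exact (Real.sqrt_sq hJ).symm

lemma singularValueSum_differential {φ : M ≃ N} (hφ : φ ∈ Diff oX oY M N) {x : X} (hx : x ∈ M) :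
    singularValueSum (differential φ x) =
      √(frobeniusNorm (differential φ x) ^ 2 + 2 * jacobian oX oY φ x) := by
  rw [← Real.sqrt_sq (singularValueSum_nonneg (differential φ x)),
    singularValueSum_sq (oX.orient x) (oY.orient (ambient φ x)),
    ← jacobian, abs_of_pos ((mem_Diff_iff.1 hφ).2 x hx)]

lemma continuousOn_singularValueSum (hM : UniqueMDiffOn (𝓡 2) M) {φ : M ≃ N}
    (hφ : φ ∈ Diff oX oY M N) :
    ContinuousOn (fun x ↦ singularValueSum (differential φ x)) M :=
  (((continuousOn_frobeniusNorm_sq oX hM hφ.1).add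
    (continuousOn_const.mul (continuousOn_jacobian hM hφ))).sqrt).congr
    fun _ hx ↦ singularValueSum_differential hφ hx

lemma distSO_sq_differential {φ : M ≃ N} (hφ : φ ∈ Diff oX oY M N) {x : X} (hx : x ∈ M) :
    distSO (oX.orient x) (oY.orient (ambient φ x)) (differential φ x) ^ 2 =
      (singularValueSum (differential φ x) - 1) ^ 2 + 1 - 2 * jacobian oX oY φ x :=
  distSO_sq_eq _ _ ((mem_Diff_iff.1 hφ).2 x hx)

/-- The area formula for a map of `M` onto itself. It is what makes the mean Jacobian independent of
the competitor. -/
lemma lintegral_jacobian_self [SecondCountableTopology X] [MeasurableSpace X] [BorelSpace X]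
    (hM : UniqueMDiffOn (𝓡 2) M) (hMm : MeasurableSet M) {χ : M ≃ M} (hχ : χ ∈ Diff oX oX M M) :
    ∫⁻ x in M, ENNReal.ofReal (jacobian oX oX χ x) ∂(areaMeasure X) = areaMeasure X M := by
  have habs : ∀ x ∈ M, absJac (differential χ x) = jacobian oX oX χ x := fun x hx ↦ by
    rw [absJac, normDet_eq_abs_linJac (oX.orient x) (oX.orient (ambient χ x)),
      ← jacobian, abs_of_pos ((mem_Diff_iff.1 hχ).2 x hx)]
  have hcont : ContinuousOn (fun x ↦ absJac (differential χ x)) M :=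
    (continuousOn_jacobian hM hχ).congr habs
  have h := areaMeasure_image hMm (injOn_ambient χ) (fun x hx ↦ hχ.1.hasMFDerivWithinAt hx)
    (hcont.aemeasurable hMm).ennreal_ofReal
  rw [image_ambient] at h
  rw [h]
  exact setLIntegral_congr_fun hMm fun x hx ↦ by rw [habs x hx]

end ContinuityOfDifferential

/-! ### Averages with an equality case, and tangent lines of powers -/

section Averages

/-- If `g + k J ≥ c + k d` and `J` has mean `d`, then the mean of `g` is at least `c`, with
equality only if `g + k J = c + k d`. -/
lemma laverage_ge_and_eq_iff {X : Type*} [TopologicalSpace X] [MeasurableSpace X] [BorelSpace X]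
    {μ : Measure X} [μ.IsOpenPosMeasure] {M : Set X} (hMm : MeasurableSet M)
    (hM : M ⊆ closure (interior M)) (hM0 : M.Nonempty) (hMfin : μ M < ⊤)
    {g J : X → ℝ} {c d k : ℝ} (hc : 0 ≤ c) (hd : 0 ≤ d) (hk : 0 ≤ k)
    (hgc : ContinuousOn g M) (hJc : ContinuousOn J M)
    (hg0 : ∀ x ∈ M, 0 ≤ g x) (hJ0 : ∀ x ∈ M, 0 ≤ J x)
    (hle : ∀ x ∈ M, c + k * d ≤ g x + k * J x)
    (hJ : ∫⁻ x in M, ENNReal.ofReal (J x) ∂μ = ENNReal.ofReal d * μ M) :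
    ENNReal.ofReal c ≤ laverage (μ.restrict M) (fun x ↦ ENNReal.ofReal (g x)) ∧
    (laverage (μ.restrict M) (fun x ↦ ENNReal.ofReal (g x)) = ENNReal.ofReal c ↔
      ∀ x ∈ M, g x + k * J x = c + k * d) := by
  have hpos : μ M ≠ 0 := by
    have hi : (interior M).Nonempty := by
      rw [← closure_nonempty_iff]
      exact hM0.mono hM
    exact ((isOpen_interior.measure_pos μ hi).trans_le (measure_mono interior_subset)).ne'
  have hsum : ∫⁻ x in M, ENNReal.ofReal (g x + k * J x) ∂μ =
      ∫⁻ x in M, ENNReal.ofReal (g x) ∂μ + ENNReal.ofReal (k * d) * μ M := by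
    have h1 : ∫⁻ x in M, ENNReal.ofReal (g x + k * J x) ∂μ =
        ∫⁻ x in M, (ENNReal.ofReal (g x) + ENNReal.ofReal k * ENNReal.ofReal (J x)) ∂μ :=
      setLIntegral_congr_fun hMm fun x hx ↦ by
        rw [ENNReal.ofReal_add (hg0 x hx) (mul_nonneg hk (hJ0 x hx)), ENNReal.ofReal_mul hk]
    rw [h1, lintegral_add_left' (hgc.aemeasurable hMm).ennreal_ofReal,
      lintegral_const_mul' _ _ ENNReal.ofReal_ne_top, hJ, ENNReal.ofReal_mul hk, mul_assoc]
  have hconst : ∫⁻ x in M, ENNReal.ofReal (c + k * d) ∂μ =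
      ENNReal.ofReal c * μ M + ENNReal.ofReal (k * d) * μ M := by
    rw [setLIntegral_const, ENNReal.ofReal_add hc (mul_nonneg hk hd), add_mul]
  -- Finiteness of this term allows it to be cancelled in `ENNReal`; here the finite area enters.
  have hfin : ENNReal.ofReal (k * d) * μ M ≠ ⊤ := ENNReal.mul_ne_top ENNReal.ofReal_ne_top hMfin.ne
  have hle' : (fun _ ↦ ENNReal.ofReal (c + k * d)) ≤ᵐ[μ.restrict M]
      fun x ↦ ENNReal.ofReal (g x + k * J x) := by
    filter_upwards [ae_restrict_mem hMm] with x hx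
    exact ENNReal.ofReal_le_ofReal (hle x hx)
  have hcm : ContinuousOn (fun x ↦ g x + k * J x) M := hgc.add (continuousOn_const.mul hJc)
  rw [laverage_eq, Measure.restrict_apply_univ]
  constructor
  · rw [ENNReal.le_div_iff_mul_le (Or.inl hpos) (Or.inl hMfin.ne)]
    have h := lintegral_mono_ae hle'
    rw [hsum, hconst] at h
    exact (ENNReal.add_le_add_iff_right hfin).1 h
  · rw [eq_comm, ENNReal.eq_div_iff hpos hMfin.ne]
    constructor
    · intro h
      have hae := ae_eq_of_ae_le_of_lintegral_le hle' (by
          rw [hconst]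
          exact ENNReal.add_ne_top.2
            ⟨ENNReal.mul_ne_top ENNReal.ofReal_ne_top hMfin.ne, hfin⟩)
        (hcm.aemeasurable hMm).ennreal_ofReal (by rw [hsum, hconst, ← h, mul_comm])
      have hae' : (fun x ↦ g x + k * J x) =ᵐ[μ.restrict M] fun _ ↦ c + k * d := by
        filter_upwards [hae, ae_restrict_mem hMm] with x hx hxM
        exact ((ENNReal.ofReal_eq_ofReal_iff (by positivity)
          (add_nonneg (hg0 x hxM) (mul_nonneg hk (hJ0 x hxM)))).1 hx).symm
      -- Both sides are continuous on `M`, and `M` lies in the closure of its interior, so almost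
      -- everywhere equality becomes equality everywhere, boundary included.
      exact Measure.eqOn_of_ae_eq hae' hcm continuousOn_const hM
    · intro h
      have h1 : ∫⁻ x in M, ENNReal.ofReal (g x + k * J x) ∂μ =
          ∫⁻ x in M, ENNReal.ofReal (c + k * d) ∂μ :=
        setLIntegral_congr_fun hMm fun x hx ↦ by rw [h x hx]
      rw [hsum, hconst] at h1
      rw [mul_comm]
      exact ((ENNReal.add_left_inj hfin).1 h1).symm

/-- Bernoulli's inequality at `t / m - 1`, multiplied by `m ^ q`. -/
lemma tangent_line_le_rpow {t m q : ℝ} (ht : 0 ≤ t) (hm : 0 < m) (hq : 1 ≤ q) :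
    m ^ q + q * m ^ (q - 1) * (t - m) ≤ t ^ q := by
  have h := one_add_mul_self_le_rpow_one_add (s := t / m - 1)
    (by have := div_nonneg ht hm.le; linarith) hq
  rw [add_sub_cancel, Real.div_rpow ht hm.le, le_div_iff₀ (by positivity)] at h
  have h1 : m ^ q = m ^ (q - 1) * m := by
    rw [← Real.rpow_add_one hm.ne', sub_add_cancel]
  refine le_trans (le_of_eq ?_) h
  rw [h1]
  field_simp

lemma tangent_line_lt_rpow {t m q : ℝ} (ht : 0 ≤ t) (hm : 0 < m) (hq : 1 < q) (htm : t ≠ m) :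
    m ^ q + q * m ^ (q - 1) * (t - m) < t ^ q := by
  have h := one_add_mul_self_lt_rpow_one_add (s := t / m - 1)
    (by have := div_nonneg ht hm.le; linarith)
    (by rw [sub_ne_zero, Ne, div_eq_one_iff_eq hm.ne']; exact htm) hq
  rw [add_sub_cancel, Real.div_rpow ht hm.le, lt_div_iff₀ (by positivity)] at h
  have h1 : m ^ q = m ^ (q - 1) * m := by
    rw [← Real.rpow_add_one hm.ne', sub_add_cancel]
  refine lt_of_eq_of_lt ?_ h
  rw [h1]
  field_simp

end Averages

/-! ### The energy bound, its equality case and the minimizers -/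

section Energy

variable {X : Type*} [TopologicalSpace X] [SecondCountableTopology X] [Nonempty X]
  [MeasurableSpace X] [BorelSpace X] [ChartedSpace Plane X] [IsManifold (𝓡 2) ∞ X]
  [RiemannianBundle (fun x : X ↦ TangentSpace (𝓡 2) x)]
  [IsContMDiffRiemannianBundle (𝓡 2) ∞ Plane (fun x : X ↦ TangentSpace (𝓡 2) x)]
  {Y : Type*} [TopologicalSpace Y] [Nonempty Y] [ChartedSpace Plane Y] [IsManifold (𝓡 2) ∞ Y]
  [RiemannianBundle (fun y : Y ↦ TangentSpace (𝓡 2) y)]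
  [IsContMDiffRiemannianBundle (𝓡 2) ∞ Plane (fun y : Y ↦ TangentSpace (𝓡 2) y)]
  {oX : SurfaceOrientation X} {oY : SurfaceOrientation Y} {M : Set X} {N : Set Y}

lemma pullBack_trans (ψ φ : M ≃ N) : (pullBack ψ φ).trans ψ = φ := by
  ext x; simp [pullBack]

lemma jacobian_eq_mul_pullBack (hM : UniqueMDiffOn (𝓡 2) M) {lam : ℝ} {ψ φ : M ≃ N}
    (hψ : ψ ∈ Diff oX oY M N) (hψ' : ScalesMetric lam ψ) (hφ : φ ∈ Diff oX oY M N) {x : X}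
    (hx : x ∈ M) : jacobian oX oY φ x = lam ^ 2 * jacobian oX oX (pullBack ψ φ) x := by
  have hχ : pullBack ψ φ ∈ Diff oX oX M M := Diff_trans hM hφ (Diff_symm hM hψ)
  have h := jacobian_trans (oX := oX) (oY := oX) (oZ := oY) hM hχ.1 hψ.1 hx
  rwa [pullBack_trans, hψ'.jacobian_eq hψ (mapsTo_ambient _ hx)] at h

lemma singularValueSum_eq_mul_pullBack (hM : UniqueMDiffOn (𝓡 2) M) {lam : ℝ} (hlam : 0 < lam)
    {ψ φ : M ≃ N} (hψ : ψ ∈ Diff oX oY M N) (hψ' : ScalesMetric lam ψ)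
    (hφ : φ ∈ Diff oX oY M N) {x : X} (hx : x ∈ M) :
    singularValueSum (differential φ x) =
      lam * singularValueSum (differential (pullBack ψ φ) x) := by
  have hχ : pullBack ψ φ ∈ Diff oX oX M M := Diff_trans hM hφ (Diff_symm hM hψ)
  have h := hψ'.singularValueSum_trans hM hχ.1 hψ.1 hlam.le hx
  rwa [pullBack_trans] at h

/-- The energy bound, and the case of equality. -/
theorem energy_ge_and_eq_iff (hM0 : M.Nonempty) (hM : HasLipschitzBoundary M)
    (hMarea : areaMeasure X M < ⊤) {lam : ℝ} (hlam : 0 < lam) (hlam' : lam ≤ 1 / 2)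
    {ψ φ : M ≃ N} (hψ : ψ ∈ Diff oX oY M N) (hψ' : ScalesMetric lam ψ)
    (hφ : φ ∈ Diff oX oY M N) {p : ℝ} (hp : 2 ≤ p) :
    ENNReal.ofReal ((1 - 2 * lam ^ 2) ^ (p / 2)) ≤ energy oX oY p φ ∧
    (energy oX oY p φ = ENNReal.ofReal ((1 - 2 * lam ^ 2) ^ (p / 2)) ↔
      ∀ x ∈ M, singularValueSum (differential φ x) = 1 ∧
        (2 < p → jacobian oX oY φ x = lam ^ 2)) := by
  have hMu := hM.uniqueMDiffOn
  have hMm := hM.measurableSet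
  set m : ℝ := 1 - 2 * lam ^ 2 with hm
  -- Since `lam ≤ 1 / 2`, in fact `m ≥ 1 / 2`; the tangent line at `m` needs `m` positive.
  have hm0 : 0 < m := by nlinarith
  set q : ℝ := p / 2 with hq
  have hq1 : 1 ≤ q := by rw [hq]; linarith
  set d : X → ℝ := fun x ↦
    distSO (oX.orient x) (oY.orient (ambient φ x)) (differential φ x) with hd
  set S : X → ℝ := fun x ↦ singularValueSum (differential φ x) with hS
  set J : X → ℝ := jacobian oX oY φ with hJ
  set t : X → ℝ := fun x ↦ (S x - 1) ^ 2 + 1 - 2 * J x with ht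
  have hdt : ∀ x ∈ M, d x ^ 2 = t x := fun x hx ↦ distSO_sq_differential hφ hx
  have ht0 : ∀ x ∈ M, 0 ≤ t x := fun x hx ↦ (hdt x hx) ▸ sq_nonneg _
  have hdp : ∀ x ∈ M, d x ^ p = t x ^ q := fun x hx ↦ by
    rw [← hdt x hx, ← Real.rpow_natCast, ← Real.rpow_mul (distSO_nonneg _ _ _), hq]
    congr 1
    push_cast
    ring
  have hJpos : ∀ x ∈ M, 0 < J x := (mem_Diff_iff.1 hφ).2
  have hJc : ContinuousOn J M := continuousOn_jacobian hMu hφ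
  have htc : ContinuousOn t M :=
    ((((continuousOn_singularValueSum hMu hφ).sub continuousOn_const).pow 2).add
      continuousOn_const).sub (continuousOn_const.mul hJc)
  -- Twice the slope of `t ↦ t ^ q` at `m`: as `t` contains `-2 * J`, adding `k * J` cancels the
  -- Jacobian in the tangent line, and only a multiple of `(S - 1) ^ 2` remains above the constant.
  set k : ℝ := 2 * (q * m ^ (q - 1)) with hk
  have hk' : 0 < q * m ^ (q - 1) := by positivity
  have hle : ∀ x ∈ M, m ^ q + k * lam ^ 2 ≤ t x ^ q + k * J x := by
    intro x hx
    have h1 := tangent_line_le_rpow (ht0 x hx) hm0 hq1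
    have h2 := mul_nonneg hk'.le (sq_nonneg (S x - 1))
    have h3 : t x - m = (S x - 1) ^ 2 + 2 * lam ^ 2 - 2 * J x := by rw [ht, hm]; ring
    rw [h3] at h1
    rw [hk]
    linarith
  have hEq : ∀ x ∈ M, t x ^ q + k * J x = m ^ q + k * lam ^ 2 ↔
      S x = 1 ∧ (2 < p → J x = lam ^ 2) := by
    intro x hx
    have h3 : t x - m = (S x - 1) ^ 2 + 2 * lam ^ 2 - 2 * J x := by rw [ht, hm]; ring
    constructor
    · intro h
      have h1 := tangent_line_le_rpow (ht0 x hx) hm0 hq1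
      have h2 := mul_nonneg hk'.le (sq_nonneg (S x - 1))
      rw [h3] at h1
      rw [hk] at h
      have h4 : q * m ^ (q - 1) * (S x - 1) ^ 2 = 0 := by linarith
      have h5 : (S x - 1) ^ 2 = 0 := (mul_eq_zero.1 h4).resolve_left hk'.ne'
      have h6 : S x = 1 := sub_eq_zero.1 (sq_eq_zero_iff.1 h5)
      refine ⟨h6, fun hp2 ↦ ?_⟩
      by_contra hne
      -- With `S = 1`, the value `t = m` would already mean `J = lam ^ 2`; otherwise strict
      -- convexity contradicts equality.
      have htm : t x ≠ m := by
        intro htm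
        rw [htm, sub_self, h5] at h3
        apply hne
        linarith
      have h7 := tangent_line_lt_rpow (ht0 x hx) hm0 (by linarith : 1 < q) htm
      rw [h3, h5] at h7
      linarith
    · rintro ⟨h1, h2⟩
      rcases hp.eq_or_lt with h | h
      · have hq' : q = 1 := by rw [hq, ← h]; norm_num
        rw [hk, hq']
        simp only [Real.rpow_one, sub_self, Real.rpow_zero]
        simp only [ht, hm, h1]
        ring
      · have h3 : t x = m := by
          rw [h2 h, h1] at h3
          linarith
        rw [h3, h2 h]
  have hJint : ∫⁻ x in M, ENNReal.ofReal (J x) ∂(areaMeasure X) =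
      ENNReal.ofReal (lam ^ 2) * areaMeasure X M := by
    have hχ : pullBack ψ φ ∈ Diff oX oX M M := Diff_trans hMu hφ (Diff_symm hMu hψ)
    rw [← lintegral_jacobian_self hMu hMm hχ, ← lintegral_const_mul' _ _ ENNReal.ofReal_ne_top]
    refine setLIntegral_congr_fun hMm fun x hx ↦ ?_
    change ENNReal.ofReal (jacobian oX oY φ x) = _
    rw [jacobian_eq_mul_pullBack hMu hψ hψ' hφ hx, ENNReal.ofReal_mul (sq_nonneg _)]
  have henergy : energy oX oY p φ =
      laverage ((areaMeasure X).restrict M) fun x ↦ ENNReal.ofReal (t x ^ q) := by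
    rw [energy, laverage_eq, laverage_eq]
    congr 1
    exact setLIntegral_congr_fun hMm fun x hx ↦ by
      change ENNReal.ofReal (d x ^ p) = _
      rw [hdp x hx]
  have key := laverage_ge_and_eq_iff (μ := areaMeasure X) hMm hM.subset_closure_interior hM0 hMarea
    (g := fun x ↦ t x ^ q) (J := J) (c := m ^ q) (d := lam ^ 2) (k := k) (by positivity)
    (sq_nonneg _) (by positivity) (htc.rpow_const fun x _ ↦ Or.inr (by linarith)) hJc
    (fun x hx ↦ Real.rpow_nonneg (ht0 x hx) _) (fun x hx ↦ (hJpos x hx).le) hle hJint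
  rw [henergy]
  exact ⟨key.1, key.2.trans (forall₂_congr hEq)⟩

/-- The self-diffeomorphisms of `M` that correspond to the minimizers of the `p`-energy. -/
def criticalSelfMaps (oX : SurfaceOrientation X) (M : Set X) (c p : ℝ) : Set (M ≃ M) :=
  {χ | χ ∈ Diff oX oX M M ∧ HasSingularValueSum c χ ∧ (2 < p → IsAreaPreserving oX oX χ)}

lemma energy_eq_iff_pullBack_mem (hM0 : M.Nonempty) (hM : HasLipschitzBoundary M)
    (hMarea : areaMeasure X M < ⊤) {lam : ℝ} (hlam : 0 < lam) (hlam' : lam ≤ 1 / 2)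
    {ψ φ : M ≃ N} (hψ : ψ ∈ Diff oX oY M N) (hψ' : ScalesMetric lam ψ)
    (hφ : φ ∈ Diff oX oY M N) {p : ℝ} (hp : 2 ≤ p) :
    energy oX oY p φ = ENNReal.ofReal ((1 - 2 * lam ^ 2) ^ (p / 2)) ↔
      pullBack ψ φ ∈ criticalSelfMaps oX M (1 / lam) p := by
  have hMu := hM.uniqueMDiffOn
  have hχ : pullBack ψ φ ∈ Diff oX oX M M := Diff_trans hMu hφ (Diff_symm hMu hψ)
  have hS : ∀ x ∈ M, (singularValueSum (differential φ x) = 1 ↔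
      singularValueSum (differential (pullBack ψ φ) x) = 1 / lam) := fun x hx ↦ by
    rw [singularValueSum_eq_mul_pullBack hMu hlam hψ hψ' hφ hx, eq_div_iff hlam.ne', mul_comm]
  have hJ : ∀ x ∈ M, (jacobian oX oY φ x = lam ^ 2 ↔ jacobian oX oX (pullBack ψ φ) x = 1) :=
    fun x hx ↦ by
      rw [jacobian_eq_mul_pullBack hMu hψ hψ' hφ hx]
      exact mul_eq_left₀ (pow_ne_zero 2 hlam.ne')
  rw [(energy_ge_and_eq_iff hM0 hM hMarea hlam hlam' hψ hψ' hφ hp).2]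
  constructor
  · intro h
    exact ⟨hχ, fun x hx ↦ (hS x hx).1 (h x hx).1,
      fun h2 ↦ isAreaPreserving_iff.2 fun x hx ↦ (hJ x hx).1 ((h x hx).2 h2)⟩
  · rintro ⟨-, h1, h2⟩ x hx
    exact ⟨(hS x hx).2 (h1 x hx), fun hp2 ↦ (hJ x hx).2 (isAreaPreserving_iff.1 (h2 hp2) x hx)⟩

/-- The bound holds for every competitor, so the minimum has this value exactly when some `φ`
attains it, and `φ = ψ ∘ χ` translates attainment into a condition on `χ`. Once the value is
attained, being a minimizer is the same as attaining it, and both energy ranges reduce to one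
statement. -/
theorem minEnergyEq_iff_and_bijOn (hM0 : M.Nonempty) (hM : HasLipschitzBoundary M)
    (hMarea : areaMeasure X M < ⊤) (hN : HasLipschitzBoundary N) {lam : ℝ} (hlam : 0 < lam)
    (hlam' : lam ≤ 1 / 2) {ψ : M ≃ N} (hψ : ψ ∈ Diff oX oY M N) (hψ' : ScalesMetric lam ψ)
    {p : ℝ} (hp : 2 ≤ p) :
    (MinEnergyEq oX oY p M N (ENNReal.ofReal ((1 - 2 * lam ^ 2) ^ (p / 2))) ↔
      (criticalSelfMaps oX M (1 / lam) p).Nonempty) ∧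
    (MinEnergyEq oX oY p M N (ENNReal.ofReal ((1 - 2 * lam ^ 2) ^ (p / 2))) →
      BijOn (fun C ↦ pullBack ψ '' C) (equivalenceClasses oX oY (minimizers oX oY p M N))
        (equivalenceClasses oX oX (criticalSelfMaps oX M (1 / lam) p))) := by
  have hMu := hM.uniqueMDiffOn
  have hNu := hN.uniqueMDiffOn
  have hlower : ENNReal.ofReal ((1 - 2 * lam ^ 2) ^ (p / 2)) ∈
      lowerBounds (energy oX oY p '' Diff oX oY M N) := by
    rintro _ ⟨φ, hφ, rfl⟩
    exact (energy_ge_and_eq_iff hM0 hM hMarea hlam hlam' hψ hψ' hφ hp).1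
  have hiff : ∀ φ, φ ∈ Diff oX oY M N →
      (energy oX oY p φ = ENNReal.ofReal ((1 - 2 * lam ^ 2) ^ (p / 2)) ↔
        pullBack ψ φ ∈ criticalSelfMaps oX M (1 / lam) p) := fun φ hφ ↦
    energy_eq_iff_pullBack_mem hM0 hM hMarea hlam hlam' hψ hψ' hφ hp
  refine ⟨⟨?_, ?_⟩, fun h ↦ bijOn_equivalenceClasses hMu hNu hψ hlam.ne' hψ' fun φ ↦ ?_⟩
  · rintro ⟨⟨φ, hφ, h⟩, -⟩
    exact ⟨_, (hiff φ hφ).1 h⟩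
  · rintro ⟨χ, hχ⟩
    have hφ : χ.trans ψ ∈ Diff oX oY M N := Diff_trans hMu hχ.1 hψ
    refine ⟨⟨χ.trans ψ, hφ, (hiff _ hφ).2 ?_⟩, hlower⟩
    rwa [pullBack_trans_self]
  · obtain ⟨φ₀, hφ₀, h₀⟩ := h.1
    constructor
    · rintro ⟨hφ, hmin⟩
      exact (hiff φ hφ).1 (le_antisymm ((hmin φ₀ hφ₀).trans h₀.le) (hlower ⟨φ, hφ, rfl⟩))
    · intro hχ
      have hφ : φ ∈ Diff oX oY M N := (pullBack_mem_Diff_iff hMu hψ).1 hχ.1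
      refine ⟨hφ, fun φ' hφ' ↦ ?_⟩
      rw [(hiff φ hφ).2 hχ]
      exact hlower ⟨φ', hφ', rfl⟩

end Energy

end SurfaceDistortion

end

theorem theorem2p5
    {X : Type*} [TopologicalSpace X] [T2Space X] [SecondCountableTopology X] [Nonempty X]
    [MeasurableSpace X] [BorelSpace X]
    [ChartedSpace Plane X] [IsManifold (𝓡 2) ∞ X]
    [RiemannianBundle (fun x : X ↦ TangentSpace (𝓡 2) x)]
    [IsContMDiffRiemannianBundle (𝓡 2) ∞ Plane
      (fun x : X ↦ TangentSpace (𝓡 2) x)]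
    {Y : Type*} [TopologicalSpace Y] [T2Space Y] [SecondCountableTopology Y] [Nonempty Y]
    [ChartedSpace Plane Y] [IsManifold (𝓡 2) ∞ Y]
    [RiemannianBundle (fun y : Y ↦ TangentSpace (𝓡 2) y)]
    [IsContMDiffRiemannianBundle (𝓡 2) ∞ Plane
      (fun y : Y ↦ TangentSpace (𝓡 2) y)]
    (oX : SurfaceOrientation X) (oY : SurfaceOrientation Y)
    -- the surfaces `M` and `N = lam M`
    (M : Set X) (hMconn : IsConnected M) (hM : HasLipschitzBoundary M)
    -- automatic if `M` is compact
    (hMarea : areaMeasure X M < ⊤)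
    (N : Set Y) (hN : HasLipschitzBoundary N)
    (lam : ℝ) (hlam : 0 < lam) (hlam' : lam ≤ 1 / 2)
    -- an orientation preserving homothety `M → lam M`
    (ψ : M ≃ N) (hψ : ψ ∈ Diff oX oY M N)
    (hψ' : ScalesMetric lam ψ) :
    (∀ p : ℝ, 2 < p →
      (MinEnergyEq oX oY p M N
          (ENNReal.ofReal (energyBound (lam ^ 2) ^ (p / 2))) ↔
        (areaPreservingSelfMaps oX M (1 / lam)).Nonempty) ∧
      (MinEnergyEq oX oY p M N
          (ENNReal.ofReal (energyBound (lam ^ 2) ^ (p / 2))) →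
        Set.BijOn (fun C ↦ pullBack ψ '' C)
          (equivalenceClasses oX oY
            (minimizers oX oY p M N))
          (equivalenceClasses oX oX
            (areaPreservingSelfMaps oX M (1 / lam))))) ∧
    (MinEnergyEq oX oY 2 M N
        (ENNReal.ofReal (energyBound (lam ^ 2))) ↔
      (selfMaps oX M (1 / lam)).Nonempty) ∧
    (MinEnergyEq oX oY 2 M N
        (ENNReal.ofReal (energyBound (lam ^ 2))) →
      Set.BijOn (fun C ↦ pullBack ψ '' C)
        (equivalenceClasses oX oY
          (minimizers oX oY 2 M N))
        (equivalenceClasses oX oX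
          (selfMaps oX M (1 / lam)))) := by
  have hbound : energyBound (lam ^ 2) = 1 - 2 * lam ^ 2 := by
    -- The bound `lam ≤ 1 / 2` says that `lam ^ 2 ≤ 1 / 4`, the affine branch of `F`.
    rw [energyBound, if_pos (by nlinarith)]
  -- At `p = 2` the premise `2 < p` is false, so the area condition disappears.
  have hcrit : criticalSelfMaps oX M (1 / lam) 2 = selfMaps oX M (1 / lam) := by
    ext χ
    simp [criticalSelfMaps, selfMaps]
  refine ⟨fun p hp ↦ ?_, ?_⟩
  · have hcrit' : criticalSelfMaps oX M (1 / lam) p = areaPreservingSelfMaps oX M (1 / lam) := by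
      ext χ
      simp [criticalSelfMaps, areaPreservingSelfMaps, hp, and_comm]
    rw [hbound, ← hcrit']
    exact minEnergyEq_iff_and_bijOn hMconn.nonempty hM hMarea hN hlam hlam' hψ hψ' hp.le
  · have h := minEnergyEq_iff_and_bijOn hMconn.nonempty hM hMarea hN hlam hlam' hψ hψ' le_rfl
    rw [hcrit, div_self two_ne_zero, Real.rpow_one, ← hbound] at h
    exact h
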